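/- **Proposition.** Let $\lambda_1,\lambda_2,\mu_1,\mu_2,c_1,c_2>0$ be real numbers, let $a\ge 0$ be an integer, and write $s=\lambda_1+\lambda_2+\mu_1c_1+\mu_2c_2$. Assume the stability condition $$\lambda_1>\mu_1c_1,\qquad \mu_1c_1+\mu_2c_2<\lambda_1+\lambda_2 .$$ Consider the continuous-time random walk on $\mathbb N^2$ ($0\in\mathbb N$) whose transition rates from $(n_1,n_2)$ to $(n_1+k,n_2+\ell)$ are $$\mu_1c_1\ \text{ for }(k,\ell)=(1,0),\qquad \mu_2c_2\ \text{ for }(0,1),\qquad \lambda_1\mathbf 1_{\{n_1>0\}}\ \text{ for }(-1,0),\qquad \lambda_2\mathbf 1_{\{n_2>0\}}+\lambda_1\mathbf 1_{\{n_1=0,\,n_2>a\}}\ \text{ for }(0,-1),$$ and $0$ otherwise. Let $p$ be a stationary probability distribution of this walk, i.e. a probability distribution on $\mathbb N^2$ satisfying the global balance equations, and put $$P(x,y)=\sum_{n_1,n_2\ge0}p(n_1,n_2)x^{n_1}y^{n_2},\quad P_1(x)=\sum_{n\ge0}p(n,0)x^n,\quad P_2(y)=\sum_{n\ge0}p(0,n)y^n,\quad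 P_2^-(y)=\sum_{n=0}^{a}p(0,n)y^n .$$ Let $$K(x,y)=\mu_1c_1x^2y+\mu_2c_2xy^2-s\,xy+\lambda_1y+\lambda_2x,$$ $$\Delta_1(y)=(\mu_2c_2y^2-sy+\lambda_2)^2-4\mu_1c_1\lambda_1y^2,\qquad \Delta_2(x)=(\mu_1c_1x^2-sx+\lambda_1)^2-4\mu_2c_2\lambda_2x^2 .$$ Let $0<y_1<y_2<y_3<y_4$ be the roots of $\Delta_1$, and let $x_1<x_2$ be the two smallest roots of $\Delta_2$, all of whose roots are real and positive. Let $\sigma_1$ be the analytic function on $\mathbb C\setminus([y_1,y_2]\cup[y_3,y_4])$ with $\sigma_1^2=\Delta_1$ and $\sigma_1(0)=\lambda_2$, and let $$X_0(y)=\frac{-(\mu_2c_2y^2-sy+\lambda_2)+\sigma_1(y)}{2\mu_1c_1y},\qquad X_0(0)=0,$$ be the root of $K(\cdot,y)$ that vanishes at the origin. Finally let $r_2=\sqrt{\lambda_2/(\mu_2c_2)}$ and let $C_{r_2}$ be the positively oriented circle of radius $r_2$ centred at $0$. Then for every $y\in\mathbb C$ with $|y|<r_2$ the series $P_2(y)$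 converges absolutely, both integrals below have integrable integrands, and $$P_2(y)=\frac{y\lambda_2}{2\pi\lambda_1}\int_{x_1}^{x_2}\frac{P_1(x)(\lambda_1-\mu_1c_1x^2)\sqrt{-\Delta_2(x)}}{x\,(\lambda_1+\lambda_2-(\mu_1c_1+\mu_2c_2)x)\,K(x,y)}\,dx +\frac{y}{2\pi i}\int_{C_{r_2}}\frac{(z-1)(\lambda_2-\mu_2c_2z^2)X_0(z)^2P_2^-(z)}{z^2(z-X_0(z))K(X_0(z),y)}\,dz+P(0,0).$$ (When $r_2=1$ the second integrand has a removable singularity at $z=1$.) -/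

import Mathlib

noncomputable section

namespace TrunkReservation

open scoped Real

/-- Parameters of the random walk: arrival rates `lam1, lam2`, service rates `mu1, mu2`,
capacities `c1, c2` (all positive) and the trunk reservation threshold `a`. -/
structure Model where
  lam1 : ℝ
  lam2 : ℝ
  mu1 : ℝ
  mu2 : ℝ
  c1 : ℝ
  c2 : ℝ
  a : ℕ
  lam1_pos : 0 < lam1
  lam2_pos : 0 < lam2
  mu1_pos : 0 < mu1
  mu2_pos : 0 < mu2
  c1_pos : 0 < c1
  c2_pos : 0 < c2

/-- Smaller root of `A z ^ 2 - b z + c`. -/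
def rootLo (A b c : ℝ) : ℝ := (b - √(b ^ 2 - 4 * A * c)) / (2 * A)

/-- Larger root of `A z ^ 2 - b z + c`. -/
def rootHi (A b c : ℝ) : ℝ := (b + √(b ^ 2 - 4 * A * c)) / (2 * A)

theorem root_factor {A b c : ℝ} (hA : 0 < A) (h : 4 * A * c ≤ b ^ 2) (z : ℂ) :
    A * z ^ 2 - b * z + c = A * (z - rootLo A b c) * (z - rootHi A b c) := by
  have hs : (√(b ^ 2 - 4 * A * c)) ^ 2 = b ^ 2 - 4 * A * c := Real.sq_sqrt (by linarith)
  have hs' : ((√(b ^ 2 - 4 * A * c) : ℝ) : ℂ) ^ 2 = b ^ 2 - 4 * A * c := by exact_mod_cast hs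
  have hA' : (A : ℂ) ≠ 0 := by exact_mod_cast hA.ne'
  simp only [rootLo, rootHi]
  push_cast
  field_simp
  linear_combination hs'

theorem rootLo_pos {A b c : ℝ} (hA : 0 < A) (hb : 0 < b) (hc : 0 < c) : 0 < rootLo A b c := by
  have : √(b ^ 2 - 4 * A * c) < b := by
    rw [Real.sqrt_lt' hb]; nlinarith [mul_pos hA hc]
  unfold rootLo
  apply div_pos <;> linarith

theorem rootHi_pos {A b c : ℝ} (hA : 0 < A) (hb : 0 < b) : 0 < rootHi A b c := by
  have := Real.sqrt_nonneg (b ^ 2 - 4 * A * c)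
  unfold rootHi
  positivity

theorem rootLo_mul_rootHi {A b c : ℝ} (hA : 0 < A) (h : 4 * A * c ≤ b ^ 2) :
    rootLo A b c * rootHi A b c = c / A := by
  have hs : (√(b ^ 2 - 4 * A * c)) ^ 2 = b ^ 2 - 4 * A * c := Real.sq_sqrt (by linarith)
  unfold rootLo rootHi
  field_simp
  linear_combination -hs

theorem rootHi_lt {A b b' c : ℝ} (hA : 0 < A) (hb : 0 < b) (h : b < b') :
    rootHi A b c < rootHi A b' c := by
  have : √(b ^ 2 - 4 * A * c) ≤ √(b' ^ 2 - 4 * A * c) :=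
    Real.sqrt_le_sqrt (sub_le_sub_right (pow_le_pow_left₀ hb.le h.le 2) _)
  unfold rootHi
  exact div_lt_div_of_pos_right (by linarith) (by linarith)

theorem rootLo_lt {A b b' c : ℝ} (hA : 0 < A) (hb : 0 < b) (hc : 0 < c) (h : b < b')
    (hd : 4 * A * c ≤ b ^ 2) : rootLo A b' c < rootLo A b c := by
  have h1 := rootLo_mul_rootHi hA hd
  have h2 := rootLo_mul_rootHi (b := b') (c := c) hA (by nlinarith)
  have h3 := rootHi_lt (c := c) hA hb h
  have h4 := rootLo_pos (b := b') hA (by linarith) hc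
  have h5 := rootHi_pos (c := c) hA hb
  nlinarith

namespace Model

variable (M : Model)

/-- The rate at which the walk jumps from `n` to `n + (k, l)`. -/
def jumpRate (n : ℕ × ℕ) (k l : ℤ) : ℝ :=
  if (k, l) = (1, 0) then M.mu1 * M.c1
  else if (k, l) = (0, 1) then M.mu2 * M.c2
  else if (k, l) = (-1, 0) then (if 0 < n.1 then M.lam1 else 0)
  else if (k, l) = (0, -1) then
    (if 0 < n.2 then M.lam2 else 0) + (if n.1 = 0 ∧ M.a < n.2 then M.lam1 else 0)
  else 0

/-- The transition rates of the random walk on `ℕ × ℕ`. -/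
def rate (n m : ℕ × ℕ) : ℝ := M.jumpRate n ((m.1 : ℤ) - n.1) ((m.2 : ℤ) - n.2)

/-- `p` is a stationary distribution of the random walk: a probability distribution on `ℕ × ℕ`
satisfying the global balance equations (all sums over `m` have finitely many nonzero terms). -/
structure IsStationary (p : ℕ × ℕ → ℝ) : Prop where
  nonneg : ∀ n, 0 ≤ p n
  hasSum_one : HasSum p 1
  balance : ∀ n, p n * ∑' m, M.rate n m = ∑' m, p m * M.rate m n

/-- The ergodicity (stability) condition. -/
def Stable : Prop :=
  M.mu1 * M.c1 < M.lam1 ∧ M.mu1 * M.c1 + M.mu2 * M.c2 < M.lam1 + M.lam2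

/-- Sum of all the rates in the interior of the quadrant. -/
def s : ℝ := M.lam1 + M.lam2 + M.mu1 * M.c1 + M.mu2 * M.c2

/-- The kernel `K(x, y)`. -/
def K (x y : ℂ) : ℂ :=
  M.mu1 * M.c1 * x ^ 2 * y + M.mu2 * M.c2 * x * y ^ 2 - M.s * x * y + M.lam1 * y + M.lam2 * x

/-- The discriminant of `K(·, y)`. -/
def Delta1 (y : ℂ) : ℂ :=
  (M.mu2 * M.c2 * y ^ 2 - M.s * y + M.lam2) ^ 2 - 4 * (M.mu1 * M.c1) * M.lam1 * y ^ 2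

/-- The discriminant of `K(x, ·)` at a real point. -/
def Delta2 (x : ℝ) : ℝ :=
  (M.mu1 * M.c1 * x ^ 2 - M.s * x + M.lam1) ^ 2 - 4 * (M.mu2 * M.c2) * M.lam2 * x ^ 2

/-- The two smaller roots `x1 < x2` of the quartic `Delta2`. -/
def x1 : ℝ := rootLo (M.mu1 * M.c1) (M.s + 2 * √(M.mu2 * M.c2 * M.lam2)) M.lam1
/-- See `x1`. -/
def x2 : ℝ := rootLo (M.mu1 * M.c1) (M.s - 2 * √(M.mu2 * M.c2 * M.lam2)) M.lam1

/-- The roots `y1 < y2 < y3 < y4` of the quartic `Delta1`. -/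
def y1 : ℝ := rootLo (M.mu2 * M.c2) (M.s + 2 * √(M.mu1 * M.c1 * M.lam1)) M.lam2
/-- See `y1`. -/
def y2 : ℝ := rootLo (M.mu2 * M.c2) (M.s - 2 * √(M.mu1 * M.c1 * M.lam1)) M.lam2
/-- See `y1`. -/
def y3 : ℝ := rootHi (M.mu2 * M.c2) (M.s - 2 * √(M.mu1 * M.c1 * M.lam1)) M.lam2
/-- See `y1`. -/
def y4 : ℝ := rootHi (M.mu2 * M.c2) (M.s + 2 * √(M.mu1 * M.c1 * M.lam1)) M.lam2

theorem s_sub_pos {M : Model} :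
    0 < M.s - 2 * √(M.mu1 * M.c1 * M.lam1) ∧
      4 * (M.mu2 * M.c2) * M.lam2 ≤ (M.s - 2 * √(M.mu1 * M.c1 * M.lam1)) ^ 2 := by
  have h1 := mul_pos M.mu1_pos M.c1_pos
  have h2 := mul_pos M.mu2_pos M.c2_pos
  have h3 := M.lam1_pos
  have h4 := M.lam2_pos
  have h5 : 2 * √(M.mu1 * M.c1 * M.lam1) ≤ M.mu1 * M.c1 + M.lam1 := by
    rw [← le_div_iff₀' (by norm_num), Real.sqrt_le_left (by positivity)]
    nlinarith [sq_nonneg (M.mu1 * M.c1 - M.lam1)]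
  have h6 : M.mu2 * M.c2 + M.lam2 ≤ M.s - 2 * √(M.mu1 * M.c1 * M.lam1) := by
    unfold s; linarith
  exact ⟨by linarith, by nlinarith [sq_nonneg (M.mu2 * M.c2 - M.lam2)]⟩

theorem y_order : 0 < M.y1 ∧ M.y1 < M.y2 ∧ M.y2 ≤ M.y3 ∧ M.y3 < M.y4 := by
  obtain ⟨h, h'⟩ := s_sub_pos (M := M)
  have h1 := mul_pos M.mu1_pos M.c1_pos
  have h2 := mul_pos M.mu2_pos M.c2_pos
  have h3 : 0 < √(M.mu1 * M.c1 * M.lam1) := Real.sqrt_pos.2 (mul_pos h1 M.lam1_pos)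
  have hlt : M.s - 2 * √(M.mu1 * M.c1 * M.lam1) < M.s + 2 * √(M.mu1 * M.c1 * M.lam1) := by
    linarith
  refine ⟨rootLo_pos h2 (by linarith) M.lam2_pos, rootLo_lt h2 h M.lam2_pos hlt h', ?_,
    rootHi_lt h2 h hlt⟩
  unfold y2 y3 rootLo rootHi
  gcongr
  linarith [Real.sqrt_nonneg ((M.s - 2 * √(M.mu1 * M.c1 * M.lam1)) ^ 2
    - 4 * (M.mu2 * M.c2) * M.lam2)]

theorem Delta1_eq (y : ℂ) :
    M.Delta1 y = (M.mu2 * M.c2) ^ 2 * (y - M.y1) * (y - M.y2) * (y - M.y3) * (y - M.y4) := by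
  obtain ⟨h, h'⟩ := s_sub_pos (M := M)
  have h1 := mul_pos M.mu1_pos M.c1_pos
  have h2 := mul_pos M.mu2_pos M.c2_pos
  have h3 : 0 ≤ √(M.mu1 * M.c1 * M.lam1) := Real.sqrt_nonneg _
  have e1 := root_factor h2 h' y
  have e2 := root_factor (b := M.s + 2 * √(M.mu1 * M.c1 * M.lam1)) (c := M.lam2) h2
    (by nlinarith) y
  have hq : ((√(M.mu1 * M.c1 * M.lam1) : ℝ) : ℂ) ^ 2 = M.mu1 * M.c1 * M.lam1 := by
    exact_mod_cast Real.sq_sqrt (mul_pos h1 M.lam1_pos).le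
  simp only [Delta1, y1, y2, y3, y4]
  push_cast at e1 e2
  calc _ = (M.mu2 * M.c2 * y ^ 2 - (M.s - 2 * (√(M.mu1 * M.c1 * M.lam1) : ℝ)) * y + M.lam2) *
        (M.mu2 * M.c2 * y ^ 2 - (M.s + 2 * (√(M.mu1 * M.c1 * M.lam1) : ℝ)) * y + M.lam2) := by
        linear_combination (4 * y ^ 2) * hq
    _ = _ := by rw [e1, e2]; ring

/-- The branch `σ₁` of `√Δ₁` that is analytic off the cuts `[y1, y2] ∪ [y3, y4]` and positive at
the origin. Here `w ^ (1 / 2 : ℂ)` is the principal square root, and `(y - y1) / (y - y2)` is a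
negative real or zero exactly when `y` is on the cut `[y1, y2)`. -/
def sigma1 (y : ℂ) : ℂ :=
  M.mu2 * M.c2 * ((y - M.y2) * ((y - M.y1) / (y - M.y2)) ^ (1 / 2 : ℂ))
    * ((y - M.y4) * ((y - M.y3) / (y - M.y4)) ^ (1 / 2 : ℂ))

/-- `σ₁` is a square root of `Δ₁`. -/
theorem sigma1_sq (y : ℂ) : M.sigma1 y ^ 2 = M.Delta1 y := by
  have key : ∀ u v : ℂ, (v * (u / v) ^ (1 / 2 : ℂ)) ^ 2 = v * u := by
    intro u v
    have h : ((u / v) ^ (1 / 2 : ℂ)) ^ 2 = u / v := by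
      rw [← Complex.cpow_nat_mul]; simp
    rw [mul_pow, h]
    by_cases hv : v = 0
    · simp [hv]
    · field_simp
  rw [Delta1_eq, sigma1, mul_pow, mul_pow, key, key]
  ring

/-- `σ₁` is positive at the origin. -/
theorem sigma1_zero : M.sigma1 0 = M.lam2 := by
  obtain ⟨h, h'⟩ := s_sub_pos (M := M)
  obtain ⟨o1, o2, o3, o4⟩ := M.y_order
  have h1 := mul_pos M.mu1_pos M.c1_pos
  have h2 := mul_pos M.mu2_pos M.c2_pos
  have h3 : 0 ≤ √(M.mu1 * M.c1 * M.lam1) := Real.sqrt_nonneg _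
  have p1 : M.y2 * M.y3 = M.lam2 / (M.mu2 * M.c2) := rootLo_mul_rootHi h2 h'
  have p2 : M.y1 * M.y4 = M.lam2 / (M.mu2 * M.c2) := rootLo_mul_rootHi h2 (by nlinarith)
  have e : M.y3 / M.y4 = M.y1 / M.y2 := by
    rw [div_eq_div_iff (by linarith) (by linarith)]; linarith
  have e' : (M.y3 : ℂ) / M.y4 = M.y1 / M.y2 := by exact_mod_cast e
  have hy2 : (M.y2 : ℂ) ≠ 0 := by exact_mod_cast (by linarith : M.y2 ≠ 0)
  have h2' : (M.mu2 * M.c2 : ℂ) ≠ 0 := by exact_mod_cast h2.ne'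
  have p2' : (M.y1 : ℂ) * M.y4 = M.lam2 / (M.mu2 * M.c2) := by exact_mod_cast p2
  have hs : (((M.y1 : ℂ) / M.y2) ^ (1 / 2 : ℂ)) ^ 2 = M.y1 / M.y2 := by
    rw [← Complex.cpow_nat_mul]; simp
  simp only [sigma1, zero_sub, neg_div_neg_eq, e']
  calc _ = M.mu2 * M.c2 * M.y2 * M.y4 * (((M.y1 : ℂ) / M.y2) ^ (1 / 2 : ℂ)) ^ 2 := by ring
    _ = M.mu2 * M.c2 * (M.y1 * M.y4) := by rw [hs]; field_simp
    _ = _ := by rw [p2', mul_div_cancel₀ _ h2']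

/-- `σ₁` is analytic off the cuts. -/
theorem sigma1_analytic : DifferentiableOn ℂ M.sigma1
    (((↑) : ℝ → ℂ) '' (Set.Icc M.y1 M.y2 ∪ Set.Icc M.y3 M.y4))ᶜ := by
  obtain ⟨o1, o2, o3, o4⟩ := M.y_order
  have key : ∀ (u v : ℝ) (y : ℂ), u < v → y ∉ ((↑) : ℝ → ℂ) '' Set.Icc u v →
      DifferentiableAt ℂ (fun y : ℂ => (y - v) * ((y - u) / (y - v)) ^ (1 / 2 : ℂ)) y := by
    intro u v y huv hy
    have hv : y - v ≠ 0 := by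
      intro h
      exact hy ⟨v, ⟨huv.le, le_rfl⟩, (sub_eq_zero.1 h).symm⟩
    have hsl : (y - u) / (y - v) ∈ Complex.slitPlane := by
      rw [Complex.mem_slitPlane_iff_not_le_zero]
      intro hle
      obtain ⟨t, ht, ht'⟩ : ∃ t : ℝ, t ≤ 0 ∧ (y - u) / (y - v) = t := by
        rw [Complex.le_def] at hle
        exact ⟨((y - u) / (y - v)).re, by simpa using hle.1,
          Complex.ext (by simp) (by simpa using hle.2)⟩
      rw [div_eq_iff hv] at ht'
      have h1t : (1 - t : ℂ) ≠ 0 := by exact_mod_cast (by linarith : (1 - t : ℝ) ≠ 0)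
      have hd : 0 < 1 - t := by linarith
      refine hy ⟨(u - t * v) / (1 - t), ⟨?_, ?_⟩, ?_⟩
      · rw [le_div_iff₀ hd]; nlinarith
      · rw [div_le_iff₀ hd]; nlinarith
      · push_cast
        rw [div_eq_iff h1t]
        linear_combination -ht'
    refine DifferentiableAt.mul (by fun_prop) (DifferentiableAt.cpow ?_ (by fun_prop) hsl)
    exact DifferentiableAt.div (by fun_prop) (by fun_prop) hv
  intro y hy
  rw [Set.image_union, Set.compl_union] at hy
  exact ((((differentiableAt_const _).mul (key _ _ y o2 hy.1)).mul
    (key _ _ y o4 hy.2))).differentiableWithinAt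

/-- The root `X₀(y)` of `K(·, y)` that vanishes at the origin (division by zero gives
`X0 0 = 0`). -/
def X0 (y : ℂ) : ℂ :=
  (-(M.mu2 * M.c2 * y ^ 2 - M.s * y + M.lam2) + M.sigma1 y) / (2 * (M.mu1 * M.c1) * y)

/-- `X₀(y)` is a root of `K(·, y)`. -/
theorem K_X0 {y : ℂ} (hy : y ≠ 0) : M.K (M.X0 y) y = 0 := by
  have h1 : (M.mu1 * M.c1 : ℂ) ≠ 0 := by
    exact_mod_cast (mul_pos M.mu1_pos M.c1_pos).ne'
  have hX : 2 * (M.mu1 * M.c1) * y * M.X0 y =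
      -(M.mu2 * M.c2 * y ^ 2 - M.s * y + M.lam2) + M.sigma1 y := by
    rw [X0, mul_div_cancel₀]
    exact mul_ne_zero (mul_ne_zero two_ne_zero h1) hy
  have hs := M.sigma1_sq y
  rw [show M.sigma1 y = 2 * (M.mu1 * M.c1) * y * M.X0 y +
    (M.mu2 * M.c2 * y ^ 2 - M.s * y + M.lam2) by rw [hX]; ring, Delta1] at hs
  have : (4 * (M.mu1 * M.c1) * y) * M.K (M.X0 y) y = 0 := by
    rw [K]; linear_combination hs
  exact (mul_eq_zero.1 this).resolve_left (mul_ne_zero (mul_ne_zero (by norm_num) h1) hy)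

/-- The radius `r₂`. -/
def r2 : ℝ := √(M.lam2 / (M.mu2 * M.c2))

/-- The polynomial `P₂⁻`. -/
def P2minus (p : ℕ × ℕ → ℝ) (y : ℂ) : ℂ := ∑ n ∈ Finset.range (M.a + 1), (p (0, n) : ℂ) * y ^ n

end Model

/-- The generating function of `p`. -/
def P (p : ℕ × ℕ → ℝ) (x y : ℂ) : ℂ := ∑' n : ℕ × ℕ, (p n : ℂ) * x ^ n.1 * y ^ n.2

/-- The generating function `P₁` of `n ↦ p (n, 0)`. -/
def P1 (p : ℕ × ℕ → ℝ) (x : ℂ) : ℂ := ∑' n : ℕ, (p (n, 0) : ℂ) * x ^ n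

/-- The generating function `P₂` of `n ↦ p (0, n)`. -/
def P2 (p : ℕ × ℕ → ℝ) (y : ℂ) : ℂ := ∑' n : ℕ, (p (0, n) : ℂ) * y ^ n

namespace Model

variable (M : Model)

/-- The integrand of the integral over `[x1, x2]`. -/
def integrand1 (p : ℕ × ℕ → ℝ) (y : ℂ) (x : ℝ) : ℂ :=
  P1 p x * (M.lam1 - M.mu1 * M.c1 * x ^ 2) * (√(-M.Delta2 x) : ℝ) /
    (x * (M.lam1 + M.lam2 - (M.mu1 * M.c1 + M.mu2 * M.c2) * x) * M.K x y)

/-- The integrand of the contour integral over the circle of radius `r2`. -/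
def integrand2 (p : ℕ × ℕ → ℝ) (y : ℂ) (z : ℂ) : ℂ :=
  (z - 1) * (M.lam2 - M.mu2 * M.c2 * z ^ 2) * M.X0 z ^ 2 * M.P2minus p z /
    (z ^ 2 * (z - M.X0 z) * M.K (M.X0 z) y)

end Model

end TrunkReservation

end

noncomputable section

namespace TrunkReservation

open scoped Real
open MeasureTheory Metric

/-! The balance equations give the functional equation K P = λ₂x(1-y)P₁ + λ₁(y-x)P₂ + λ₁x(1-y)P₂⁻ on
the closed unit bidisc (`functional_eq`). Putting x = X₀(z) kills the left side and expresses P₂(z)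
as `ratio z` · ((λ₂/λ₁)P₁(X₀(z)) + P₂⁻(z)), which is `continuation`. This expression makes sense
whenever |X₀(z)| ≤ 1, in particular on the circle |z| = r₂ (`norm_X0_le_one`). So when r₂ > 1 it
carries the Cauchy integrals of P₂ from the unit circle out to radius r₂, which gives convergence
and Cauchy's formula for |y| < r₂ (`circleIntegral_continuation_mul`, `hasSum_P2`).

Subtract the value at y = 0, and also a multiple of the integral against 1/(λ₂ - μ₂c₂yz), which
vanishes because the pole r₂²/y lies outside the circle. The Cauchy kernel becomes y · `weight y z`.
The P₂⁻ term is then already the contour integral of the statement.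

In the P₁ term, X₀ is real on the circle and takes the same value at z and at its conjugate w, while
z · `weight y z` changes sign under z ↔ w. Adding the contributions of z and w leaves a function of
x = X₀(z) alone, with numerator -Δ₂(x) (`add_conj_eq`). The substitution θ = arccos (`cosArg` x)
maps [x₁, x₂] onto [0, π]; its derivative cancels one factor √(-Δ₂), and the integral over [x₁, x₂]
results. -/

/-! ### Slices and index shifts of double series. -/

theorem hasSum_slice_fst {f : ℕ × ℕ → ℂ} {T : ℂ} (h : HasSum (fun n => f (0, n)) T) :
    HasSum (fun n : ℕ × ℕ => if n.1 = 0 then f n else 0) T := by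
  have hi : Function.Injective (fun n : ℕ => ((0, n) : ℕ × ℕ)) := fun a b h => by simpa using h
  rw [← hi.hasSum_iff]
  · simpa [Function.comp_def] using h
  · rintro ⟨a, b⟩ hx
    have : a ≠ 0 := fun h => hx ⟨b, by simp [h]⟩
    simp [this]

theorem hasSum_slice_snd {f : ℕ × ℕ → ℂ} {T : ℂ} (h : HasSum (fun n => f (n, 0)) T) :
    HasSum (fun n : ℕ × ℕ => if n.2 = 0 then f n else 0) T := by
  have hi : Function.Injective (fun n : ℕ => ((n, 0) : ℕ × ℕ)) := fun a b h => by simpa using h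
  rw [← hi.hasSum_iff]
  · simpa [Function.comp_def] using h
  · rintro ⟨a, b⟩ hx
    have : b ≠ 0 := fun h => hx ⟨a, by simp [h]⟩
    simp [this]

theorem hasSum_succ_fst {f : ℕ × ℕ → ℂ} {S T : ℂ} (hf : HasSum f S)
    (h : HasSum (fun n : ℕ × ℕ => if n.1 = 0 then f n else 0) T) :
    HasSum (fun n : ℕ × ℕ => f (n.1 + 1, n.2)) (S - T) := by
  have hi : Function.Injective (fun n : ℕ × ℕ => ((n.1 + 1, n.2) : ℕ × ℕ)) := by
    rintro ⟨a, b⟩ ⟨c, d⟩ h; simpa using h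
  have := hf.sub h
  rw [← hi.hasSum_iff] at this
  · simpa [Function.comp_def] using this
  · rintro ⟨a, b⟩ hx
    have : a = 0 := by
      by_contra h
      exact hx ⟨(a - 1, b), by simp; omega⟩
    simp [this]

theorem hasSum_succ_snd {f : ℕ × ℕ → ℂ} {S T : ℂ} (hf : HasSum f S)
    (h : HasSum (fun n : ℕ × ℕ => if n.2 = 0 then f n else 0) T) :
    HasSum (fun n : ℕ × ℕ => f (n.1, n.2 + 1)) (S - T) := by
  have hi : Function.Injective (fun n : ℕ × ℕ => ((n.1, n.2 + 1) : ℕ × ℕ)) := by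
    rintro ⟨a, b⟩ ⟨c, d⟩ h; simpa using h
  have := hf.sub h
  rw [← hi.hasSum_iff] at this
  · simpa [Function.comp_def] using this
  · rintro ⟨a, b⟩ hx
    have : b = 0 := by
      by_contra h
      exact hx ⟨(a, b - 1), by simp; omega⟩
    simp [this]

theorem hasSum_pred_fst {f : ℕ × ℕ → ℂ} {S : ℂ} (hf : HasSum f S) :
    HasSum (fun n : ℕ × ℕ => if 0 < n.1 then f (n.1 - 1, n.2) else 0) S := by
  have hi : Function.Injective (fun n : ℕ × ℕ => ((n.1 + 1, n.2) : ℕ × ℕ)) := by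
    rintro ⟨a, b⟩ ⟨c, d⟩ h; simpa using h
  rw [← hi.hasSum_iff]
  · simpa [Function.comp_def] using hf
  · rintro ⟨a, b⟩ hx
    have : a = 0 := by
      by_contra h
      exact hx ⟨(a - 1, b), by simp; omega⟩
    simp [this]

theorem hasSum_pred_snd {f : ℕ × ℕ → ℂ} {S : ℂ} (hf : HasSum f S) :
    HasSum (fun n : ℕ × ℕ => if 0 < n.2 then f (n.1, n.2 - 1) else 0) S := by
  have hi : Function.Injective (fun n : ℕ × ℕ => ((n.1, n.2 + 1) : ℕ × ℕ)) := by
    rintro ⟨a, b⟩ ⟨c, d⟩ h; simpa using h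
  rw [← hi.hasSum_iff]
  · simpa [Function.comp_def] using hf
  · rintro ⟨a, b⟩ hx
    have : b = 0 := by
      by_contra h
      exact hx ⟨(a, b - 1), by simp; omega⟩
    simp [this]

theorem hasSum_of_norm_le_one {q : ℕ → ℝ} (hq : Summable q) (h0 : ∀ n, 0 ≤ q n) {x : ℂ}
    (hx : ‖x‖ ≤ 1) : HasSum (fun n => (q n : ℂ) * x ^ n) (∑' n, (q n : ℂ) * x ^ n) := by
  refine (Summable.of_norm_bounded hq fun n => ?_).hasSum
  rw [norm_mul, norm_pow, Complex.norm_real, Real.norm_of_nonneg (h0 n)]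
  exact mul_le_of_le_one_right (h0 n) (pow_le_one₀ (norm_nonneg _) hx)

/-! ### Balance equations and the functional equation. -/

namespace Model

variable {M : Model}

/-- Truncated subtraction is harmless: where n.1 - 1 or n.2 - 1 is truncated, the attached
coefficient is 0. Each row thus becomes a sum of four point masses, so `hasSum_ite_eq` evaluates the
series. -/
theorem rate_eq (n m : ℕ × ℕ) : M.rate n m =
    (if m = (n.1 + 1, n.2) then M.mu1 * M.c1 else 0)
    + (if m = (n.1, n.2 + 1) then M.mu2 * M.c2 else 0)
    + (if m = (n.1 - 1, n.2) then (if 0 < n.1 then M.lam1 else 0) else 0)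
    + (if m = (n.1, n.2 - 1) then ((if 0 < n.2 then M.lam2 else 0)
      + (if n.1 = 0 ∧ M.a < n.2 then M.lam1 else 0)) else 0) := by
  obtain ⟨n1, n2⟩ := n
  obtain ⟨m1, m2⟩ := m
  simp only [rate, jumpRate, Prod.mk.injEq]
  grind (splits := 40)

theorem mul_rate_eq (p : ℕ × ℕ → ℝ) (n m : ℕ × ℕ) : p m * M.rate m n =
    (if m = (n.1 - 1, n.2) then (if 0 < n.1 then M.mu1 * M.c1 * p (n.1 - 1, n.2) else 0) else 0)
    + (if m = (n.1, n.2 - 1) then (if 0 < n.2 then M.mu2 * M.c2 * p (n.1, n.2 - 1) else 0) else 0)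
    + (if m = (n.1 + 1, n.2) then M.lam1 * p (n.1 + 1, n.2) else 0)
    + (if m = (n.1, n.2 + 1) then (M.lam2 + if n.1 = 0 ∧ M.a < n.2 + 1 then M.lam1 else 0)
      * p (n.1, n.2 + 1) else 0) := by
  obtain ⟨n1, n2⟩ := n
  obtain ⟨m1, m2⟩ := m
  simp only [rate, jumpRate, Prod.mk.injEq]
  grind (splits := 40)

theorem IsStationary.balance_eq {p : ℕ × ℕ → ℝ} (hp : M.IsStationary p) (n : ℕ × ℕ) :
    p n * (M.mu1 * M.c1 + M.mu2 * M.c2 + (if 0 < n.1 then M.lam1 else 0)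
      + ((if 0 < n.2 then M.lam2 else 0) + (if n.1 = 0 ∧ M.a < n.2 then M.lam1 else 0))) =
    (if 0 < n.1 then M.mu1 * M.c1 * p (n.1 - 1, n.2) else 0)
    + (if 0 < n.2 then M.mu2 * M.c2 * p (n.1, n.2 - 1) else 0)
    + M.lam1 * p (n.1 + 1, n.2)
    + (M.lam2 + if n.1 = 0 ∧ M.a < n.2 + 1 then M.lam1 else 0) * p (n.1, n.2 + 1) := by
  have h := hp.balance n
  simp_rw [mul_rate_eq] at h
  simp_rw [rate_eq] at h
  rwa [((((hasSum_ite_eq _ _).add (hasSum_ite_eq _ _)).add (hasSum_ite_eq _ _)).add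
      (hasSum_ite_eq _ _)).tsum_eq, ((((hasSum_ite_eq _ _).add (hasSum_ite_eq _ _)).add
      (hasSum_ite_eq _ _)).add (hasSum_ite_eq _ _)).tsum_eq] at h

theorem IsStationary.summable_norm {p : ℕ × ℕ → ℝ} (hp : M.IsStationary p) {x y : ℂ}
    (hx : ‖x‖ ≤ 1) (hy : ‖y‖ ≤ 1) :
    Summable (fun n : ℕ × ℕ => (p n : ℂ) * x ^ n.1 * y ^ n.2) := by
  refine Summable.of_norm_bounded hp.hasSum_one.summable fun n => ?_
  rw [norm_mul, norm_mul, norm_pow, norm_pow, Complex.norm_real, Real.norm_of_nonneg (hp.nonneg n),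
    mul_assoc]
  exact mul_le_of_le_one_right (hp.nonneg n)
    (mul_le_one₀ (pow_le_one₀ (norm_nonneg _) hx) (by positivity) (pow_le_one₀ (norm_nonneg _) hy))

theorem IsStationary.summable_fst {p : ℕ × ℕ → ℝ} (hp : M.IsStationary p) :
    Summable fun n => p (n, 0) :=
  hp.hasSum_one.summable.comp_injective (i := fun n : ℕ => ((n, 0) : ℕ × ℕ))
    fun a b h => by simpa using h

theorem IsStationary.summable_snd {p : ℕ × ℕ → ℝ} (hp : M.IsStationary p) :
    Summable fun n => p (0, n) :=
  hp.hasSum_one.summable.comp_injective (i := fun n : ℕ => ((0, n) : ℕ × ℕ))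
    fun a b h => by simpa using h

/-- The functional equation of the generating functions. -/
theorem IsStationary.functional_eq {p : ℕ × ℕ → ℝ} (hp : M.IsStationary p) {x y : ℂ}
    (hx : ‖x‖ ≤ 1) (hy : ‖y‖ ≤ 1) :
    M.K x y * P p x y = M.lam2 * x * (1 - y) * P1 p x + M.lam1 * (y - x) * P2 p y
      + M.lam1 * x * (1 - y) * M.P2minus p y := by
  set f : ℕ × ℕ → ℂ := fun n => (p n : ℂ) * x ^ n.1 * y ^ n.2 with hf
  have S : HasSum f (P p x y) := (hp.summable_norm hx hy).hasSum
  have S1 : HasSum (fun n : ℕ × ℕ => if n.2 = 0 then f n else 0) (P1 p x) :=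
    hasSum_slice_snd (by
      simpa [hf, P1, P2] using hasSum_of_norm_le_one hp.summable_fst (fun n => hp.nonneg _) hx)
  have S2 : HasSum (fun n : ℕ × ℕ => if n.1 = 0 then f n else 0) (P2 p y) :=
    hasSum_slice_fst (by
      simpa [hf, P1, P2] using hasSum_of_norm_le_one hp.summable_snd (fun n => hp.nonneg _) hy)
  have S3 : HasSum (fun n : ℕ × ℕ => if n.1 = 0 then (if n.2 ≤ M.a then f n else 0) else 0)
      (M.P2minus p y) := by
    refine hasSum_slice_fst (f := fun n => if n.2 ≤ M.a then f n else 0) ?_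
    have : M.P2minus p y = ∑ n ∈ Finset.range (M.a + 1),
        (if n ≤ M.a then f (0, n) else 0) := by
      refine Finset.sum_congr rfl fun n hn => ?_
      rw [if_pos (by simpa [Nat.lt_succ_iff] using hn)]
      simp [hf]
    rw [this]
    exact hasSum_sum_of_ne_finset_zero fun n hn => if_neg (by simpa using hn)
  have S4 := S2.sub S3
  -- Shifting loses nothing: P₂ - P₂⁻ has no term with n.2 = 0, since 0 ≤ a.
  have S5 : HasSum (fun n : ℕ × ℕ => (if n.1 = 0 ∧ M.a < n.2 + 1 then f (n.1, n.2 + 1) else 0))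
      (P2 p y - M.P2minus p y) := by
    have := hasSum_succ_snd (T := 0) S4 (by
      convert (hasSum_zero : HasSum (fun _ : ℕ × ℕ => (0 : ℂ)) 0) using 2 with n
      rcases n with ⟨a, b⟩
      by_cases hb : b = 0 <;> simp [hb])
    rw [sub_zero] at this
    convert this using 2 with n
    by_cases h1 : n.1 = 0 <;> by_cases h2 : M.a < n.2 + 1 <;> simp [h1, h2] <;> grind
  -- `Lh` collects outflow and `Rh` inflow; their terms at n agree by the balance equation at n
  -- times x ^ (n.1 + 1) * y ^ (n.2 + 1).
  have Lh := (((((S.mul_left (M.s : ℂ)).sub (S2.mul_left (M.lam1 : ℂ))).sub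
    (S1.mul_left (M.lam2 : ℂ))).add (S4.mul_left (M.lam1 : ℂ)))).mul_left (x * y)
  have Rh := ((((hasSum_pred_fst S).mul_left (M.mu1 * M.c1 * x ^ 2 * y)).add
    ((hasSum_pred_snd S).mul_left (M.mu2 * M.c2 * x * y ^ 2))).add
    ((hasSum_succ_fst S S2).mul_left (M.lam1 * y))).add
    (((hasSum_succ_snd S S1).mul_left (M.lam2 * x)).add (S5.mul_left (M.lam1 * x)))
  have E := Lh.unique (by
    convert Rh using 2 with n
    have hb := congrArg (fun r : ℝ => (r : ℂ) * x ^ (n.1 + 1) * y ^ (n.2 + 1)) (hp.balance_eq n)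
    obtain ⟨i, j⟩ := n
    simp only [hf, s]
    push_cast at hb ⊢
    rcases i with _ | i <;> rcases j with _ | j <;>
      simp only [if_true, if_false, Nat.succ_pos, Nat.add_sub_cancel, true_and,
        false_and, Nat.add_eq_zero_iff, one_ne_zero, and_false, not_lt_zero, Nat.zero_le] at hb ⊢
    all_goals try (split_ifs at hb ⊢ <;> first | omega | skip)
    all_goals try push_cast at hb
    all_goals linear_combination hb)
  simp only [Model.K]
  linear_combination -E


/-! ### The branch X₀ between the cuts. -/

theorem mul_mu1_c1_pos : 0 < M.mu1 * M.c1 := mul_pos M.mu1_pos M.c1_pos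

theorem mul_mu2_c2_pos : 0 < M.mu2 * M.c2 := mul_pos M.mu2_pos M.c2_pos

theorem r2_pos : 0 < M.r2 := Real.sqrt_pos.2 (div_pos M.lam2_pos mul_mu2_c2_pos)

theorem r2_sq : M.mu2 * M.c2 * M.r2 ^ 2 = M.lam2 := by
  rw [r2, Real.sq_sqrt (div_pos M.lam2_pos mul_mu2_c2_pos).le,
    mul_div_cancel₀ _ mul_mu2_c2_pos.ne']

/-- The open annulus between the two cuts of `σ₁`. -/
def annulus (M : Model) : Set ℂ := {z | M.y2 < ‖z‖ ∧ ‖z‖ < M.y3}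

theorem y2_pos : 0 < M.y2 := M.y_order.1.trans M.y_order.2.1

theorem mul_sub_y2_mul_sub_y3 (r : ℝ) : M.mu2 * M.c2 * (r - M.y2) * (r - M.y3) =
    M.mu2 * M.c2 * r ^ 2 - (M.s - 2 * √(M.mu1 * M.c1 * M.lam1)) * r + M.lam2 := by
  have := root_factor mul_mu2_c2_pos (s_sub_pos (M := M)).2 r
  exact_mod_cast this.symm

/-- The hypothesis `h` places r = |z| between 1 and r₂² = λ₂/(μ₂c₂). The quadratic with roots y₂, y₃
equals (r - 1)(μ₂c₂r - λ₂) - (μ₁c₁ + λ₁ - 2√(μ₁c₁λ₁))r, and the last bracket is positive by strict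
AM-GM, as μ₁c₁ ≠ λ₁. -/
theorem Stable.mem_annulus (hM : M.Stable) {z : ℂ} (h0 : 0 < ‖z‖)
    (h : (‖z‖ - 1) * (M.mu2 * M.c2 * ‖z‖ - M.lam2) ≤ 0) : z ∈ M.annulus := by
  have ha := mul_mu1_c1_pos (M := M)
  have hb := mul_mu2_c2_pos (M := M)
  have h5 : 2 * √(M.mu1 * M.c1 * M.lam1) < M.mu1 * M.c1 + M.lam1 := by
    rw [← lt_div_iff₀' (by norm_num), Real.sqrt_lt' (by linarith [M.lam1_pos])]
    nlinarith [sq_pos_of_pos (sub_pos.2 hM.1)]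
  have h6 : M.mu2 * M.c2 * ((‖z‖ - M.y2) * (‖z‖ - M.y3)) < 0 := by
    rw [← mul_assoc, mul_sub_y2_mul_sub_y3, s]
    nlinarith [mul_pos h0 (sub_pos.2 h5)]
  have h7 : (‖z‖ - M.y2) * (‖z‖ - M.y3) < 0 := by
    by_contra! hc
    exact absurd h6 (not_lt.2 (mul_nonneg hb.le hc))
  have h8 := M.y_order.2.2.1
  rcases mul_neg_iff.1 h7 with h | h <;> constructor <;> linarith

theorem Stable.one_mem_annulus (hM : M.Stable) : (1 : ℂ) ∈ M.annulus :=
  hM.mem_annulus (by simp) (by simp)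

/-- r₂ is the geometric mean of 1 and λ₂/(μ₂c₂). -/
theorem r2_between {r : ℝ} (hr : r = M.r2) : (r - 1) * (M.mu2 * M.c2 * r - M.lam2) ≤ 0 := by
  subst hr
  have h : M.mu2 * M.c2 * M.r2 - M.lam2 = - (M.mu2 * M.c2 * M.r2 * (M.r2 - 1)) := by
    linear_combination M.r2_sq
  rw [h]
  have := mul_nonneg (mul_pos (mul_mu2_c2_pos (M := M)) (r2_pos (M := M))).le
    (sq_nonneg (M.r2 - 1))
  nlinarith

theorem Stable.mem_annulus_of_norm_eq_r2 (hM : M.Stable) {z : ℂ} (hz : ‖z‖ = M.r2) :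
    z ∈ M.annulus :=
  hM.mem_annulus (hz ▸ r2_pos) (r2_between hz)

theorem ne_zero_of_mem_annulus {z : ℂ} (hz : z ∈ M.annulus) : z ≠ 0 :=
  norm_pos_iff.1 (y2_pos.trans hz.1)

theorem isOpen_annulus : IsOpen M.annulus :=
  (isOpen_lt continuous_const continuous_norm).inter (isOpen_lt continuous_norm continuous_const)

theorem isPreconnected_annulus : IsPreconnected M.annulus := by
  have h : M.annulus = (fun q : ℝ × ℝ => (q.1 : ℂ) * Complex.exp (q.2 * Complex.I)) ''
      (Set.Ioo M.y2 M.y3 ×ˢ Set.univ) := by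
    ext z
    constructor
    · intro hz
      exact ⟨(‖z‖, z.arg), ⟨hz, trivial⟩, Complex.norm_mul_exp_arg_mul_I z⟩
    · rintro ⟨⟨r, t⟩, ⟨hr, -⟩, rfl⟩
      have : ‖(r : ℂ) * Complex.exp (t * Complex.I)‖ = r := by
        rw [norm_mul, Complex.norm_exp_ofReal_mul_I, mul_one, Complex.norm_real,
          Real.norm_of_nonneg (y2_pos.trans hr.1).le]
      exact ⟨this.symm ▸ hr.1, this.symm ▸ hr.2⟩
  rw [h]
  exact (isPreconnected_Ioo.prod isPreconnected_univ).image _ (by fun_prop)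

theorem differentiableAt_X0 {z : ℂ} (hz : z ∈ M.annulus) : DifferentiableAt ℂ M.X0 z := by
  have hsub : M.annulus ⊆ (((↑) : ℝ → ℂ) '' (Set.Icc M.y1 M.y2 ∪ Set.Icc M.y3 M.y4))ᶜ := by
    rintro _ hw ⟨t, ht, rfl⟩
    obtain ⟨o1, o2, o3, o4⟩ := M.y_order
    have h0 : 0 ≤ t := by rcases ht with ht | ht <;> linarith [ht.1]
    simp only [annulus, Set.mem_ofPred_eq, Complex.norm_real, Real.norm_of_nonneg h0] at hw
    rcases ht with ht | ht
    · exact absurd hw.1 (not_lt.2 ht.2)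
    · exact absurd hw.2 (not_lt.2 ht.1)
  have hs : DifferentiableAt ℂ M.sigma1 z :=
    (M.sigma1_analytic.mono hsub).differentiableAt (isOpen_annulus.mem_nhds hz)
  have hne : (2 * (M.mu1 * M.c1) * z : ℂ) ≠ 0 := by
    have : (M.mu1 * M.c1 : ℂ) ≠ 0 := by exact_mod_cast mul_mu1_c1_pos.ne'
    exact mul_ne_zero (mul_ne_zero two_ne_zero this) (ne_zero_of_mem_annulus hz)
  unfold X0
  exact DifferentiableAt.div (by fun_prop) (by fun_prop) hne

theorem continuousOn_X0 : ContinuousOn M.X0 M.annulus := fun _ hz =>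
  (differentiableAt_X0 hz).continuousAt.continuousWithinAt

theorem lt_of_mem_annulus {z : ℂ} (hz : z ∈ M.annulus) :
    2 * √(M.mu1 * M.c1 * M.lam1) * ‖z‖ < M.s * ‖z‖ - M.mu2 * M.c2 * ‖z‖ ^ 2 - M.lam2 := by
  have h := mul_sub_y2_mul_sub_y3 (M := M) ‖z‖
  have := mul_pos (mul_pos (mul_mu2_c2_pos (M := M)) (sub_pos.2 hz.1)) (sub_pos.2 hz.2)
  linarith

theorem norm_mul_le_of_K_eq_zero {x z : ℂ} (h : M.K x z = 0) :
    ‖x‖ * (M.s * ‖z‖ - M.mu2 * M.c2 * ‖z‖ ^ 2 - M.lam2) ≤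
      (M.mu1 * M.c1 * ‖x‖ ^ 2 + M.lam1) * ‖z‖ := by
  have hs : 0 < M.s := by
    have := mul_mu1_c1_pos (M := M)
    have := mul_mu2_c2_pos (M := M)
    have := M.lam1_pos
    have := M.lam2_pos
    unfold s; positivity
  have ha := mul_mu1_c1_pos (M := M)
  have hb := mul_mu2_c2_pos (M := M)
  have e : (M.s : ℂ) * x * z = ((M.mu1 * M.c1 : ℝ) * x ^ 2 * z + M.lam1 * z)
      + ((M.mu2 * M.c2 : ℝ) * x * z ^ 2 + M.lam2 * x) := by
    push_cast
    simp only [K] at h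
    linear_combination -h
  have h1 := congrArg norm e
  have h2 := norm_add_le ((M.mu1 * M.c1 : ℝ) * x ^ 2 * z + M.lam1 * z)
    (((M.mu2 * M.c2 : ℝ) : ℂ) * x * z ^ 2 + M.lam2 * x)
  have h3 := norm_add_le (((M.mu1 * M.c1 : ℝ) : ℂ) * x ^ 2 * z) (M.lam1 * z)
  have h4 := norm_add_le (((M.mu2 * M.c2 : ℝ) : ℂ) * x * z ^ 2) (M.lam2 * x)
  simp only [norm_mul, norm_pow, Complex.norm_real, Real.norm_of_nonneg ha.le,
    Real.norm_of_nonneg hb.le, Real.norm_of_nonneg hs.le, Real.norm_of_nonneg M.lam1_pos.le,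
    Real.norm_of_nonneg M.lam2_pos.le] at h1 h2 h3 h4
  nlinarith

/-- The triangle inequality applied to K = 0 contradicts `lt_of_mem_annulus` on the critical circle
|x|² = λ₁/(μ₁c₁). Hence a root of K(·, z) depending continuously on z cannot cross that circle while
z stays in the annulus. -/
theorem mul_norm_sq_ne {x z : ℂ} (hz : z ∈ M.annulus) (h : M.K x z = 0) :
    M.mu1 * M.c1 * ‖x‖ ^ 2 ≠ M.lam1 := by
  intro hx
  have ha := mul_mu1_c1_pos (M := M)
  have hz0 : 0 < ‖z‖ := y2_pos.trans hz.1
  have h1 := lt_of_mem_annulus hz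
  have h2 := norm_mul_le_of_K_eq_zero h
  have h3 : √(M.mu1 * M.c1 * M.lam1) = M.mu1 * M.c1 * ‖x‖ := by
    rw [← hx, show M.mu1 * M.c1 * (M.mu1 * M.c1 * ‖x‖ ^ 2) = (M.mu1 * M.c1 * ‖x‖) ^ 2 by ring,
      Real.sqrt_sq (by positivity)]
  have h4 : 0 < ‖x‖ := by
    rcases (norm_nonneg x).eq_or_lt with h | h
    · rw [← h] at hx; linarith [M.lam1_pos]
    · exact h
  rw [h3] at h1
  nlinarith

/-- Δ₁(1) = (λ₁ - μ₁c₁)², and σ₁ is negative on (y₂, y₃), which contains 1. This selects the root 1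
rather than λ₁/(μ₁c₁). -/
theorem Stable.X0_one (hM : M.Stable) : M.X0 1 = 1 := by
  obtain ⟨o1, o2, o3, o4⟩ := M.y_order
  have ha := mul_mu1_c1_pos (M := M)
  have hb := mul_mu2_c2_pos (M := M)
  have h := hM.one_mem_annulus
  simp only [annulus, Set.mem_ofPred_eq, norm_one] at h
  have hroot : ∀ u v : ℝ, 0 ≤ u / v → ((u : ℂ) / v) ^ (1 / 2 : ℂ) = √(u / v) := by
    intro u v huv
    rw [Real.sqrt_eq_rpow, Complex.ofReal_cpow huv]
    push_cast
    rfl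
  have p1 : 0 < (1 - M.y1) / (1 - M.y2) := div_pos (by linarith) (by linarith)
  have p2 : 0 < (1 - M.y3) / (1 - M.y4) := div_pos_of_neg_of_neg (by linarith) (by linarith)
  have e : M.sigma1 1 = ((M.mu2 * M.c2 * ((1 - M.y2) * √((1 - M.y1) / (1 - M.y2)))
      * ((1 - M.y4) * √((1 - M.y3) / (1 - M.y4))) : ℝ) : ℂ) := by
    have e1 := hroot _ _ p1.le
    have e2 := hroot _ _ p2.le
    push_cast at e1 e2
    simp only [sigma1, e1, e2]
    push_cast
    ring
  set t := M.mu2 * M.c2 * ((1 - M.y2) * √((1 - M.y1) / (1 - M.y2)))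
      * ((1 - M.y4) * √((1 - M.y3) / (1 - M.y4))) with ht
  have ht0 : t < 0 := mul_neg_of_pos_of_neg
    (mul_pos hb (mul_pos (by linarith) (Real.sqrt_pos.2 p1)))
    (mul_neg_of_neg_of_pos (by linarith) (Real.sqrt_pos.2 p2))
  have ht2 : t ^ 2 = (M.lam1 - M.mu1 * M.c1) ^ 2 := by
    have := M.sigma1_sq 1
    rw [e] at this
    simp only [Delta1, s] at this
    have h' : ((t ^ 2 : ℝ) : ℂ) = (((M.lam1 - M.mu1 * M.c1) ^ 2 : ℝ) : ℂ) := by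
      push_cast at this ⊢
      rw [this]; ring
    exact_mod_cast h'
  have ht3 : t = -(M.lam1 - M.mu1 * M.c1) := by
    rcases sq_eq_sq_iff_eq_or_eq_neg.1 ht2 with h | h
    · linarith [hM.1]
    · exact h
  have ha' : (M.mu1 * M.c1 : ℂ) ≠ 0 := by exact_mod_cast ha.ne'
  rw [X0, e, ht3, s, div_eq_one_iff_eq (by simpa using ha')]
  push_cast
  ring

/-- The inequality holds at z = 1, and equality never occurs on the connected annulus. -/
theorem Stable.mul_norm_X0_sq_lt (hM : M.Stable) {z : ℂ} (hz : z ∈ M.annulus) :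
    M.mu1 * M.c1 * ‖M.X0 z‖ ^ 2 < M.lam1 := by
  have hK : ∀ w ∈ M.annulus, M.mu1 * M.c1 * ‖M.X0 w‖ ^ 2 ≠ M.lam1 := fun w hw =>
    mul_norm_sq_ne hw (M.K_X0 (ne_zero_of_mem_annulus hw))
  by_contra! h
  have hc : ContinuousOn (fun w => M.mu1 * M.c1 * ‖M.X0 w‖ ^ 2) M.annulus :=
    ((continuousOn_X0.norm).pow 2).const_smul (M.mu1 * M.c1)
  obtain ⟨w, hw, hw'⟩ := isPreconnected_annulus.intermediate_value hM.one_mem_annulus hz hc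
    (show M.lam1 ∈ _ from ⟨by simpa [hM.X0_one] using hM.1.le, h⟩)
  exact hK w hw hw'

/-- `X₀(z)` is the root of `K(·, z)` of smaller modulus. -/
theorem Stable.eq_X0 (hM : M.Stable) {x z : ℂ} (hz : z ∈ M.annulus) (h : M.K x z = 0)
    (hx : M.mu1 * M.c1 * ‖x‖ ^ 2 < M.lam1) : M.X0 z = x := by
  have hz0 := ne_zero_of_mem_annulus hz
  have h0 := M.K_X0 hz0
  have hX := hM.mul_norm_X0_sq_lt hz
  by_contra hne
  simp only [K] at h h0
  -- Vieta: two distinct roots have product λ₁/(μ₁c₁), so they cannot both lie inside the critical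
  -- circle.
  have h1 : M.mu1 * M.c1 * z * (x + M.X0 z) + M.mu2 * M.c2 * z ^ 2 - M.s * z + M.lam2 = 0 := by
    refine (mul_eq_zero.1 ?_).resolve_left (sub_ne_zero.2 hne)
    linear_combination h0 - h
  have h2 : ((M.mu1 * M.c1 : ℝ) : ℂ) * (x * M.X0 z) = (M.lam1 : ℝ) := by
    refine mul_left_cancel₀ hz0 ?_
    push_cast
    linear_combination M.X0 z * h1 - h0
  have h3 := congrArg norm h2
  have ha := mul_mu1_c1_pos (M := M)
  simp only [norm_mul, Complex.norm_real, Real.norm_of_nonneg ha.le,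
    Real.norm_of_nonneg M.lam1_pos.le] at h3
  have := two_mul_le_add_sq ‖x‖ ‖M.X0 z‖
  nlinarith

/-- With t = |X₀(z)|, the triangle inequality gives (t - 1)(μ₁c₁t - λ₁) ≥ 0. If t > 1, then μ₁c₁t <
μ₁c₁t² < λ₁ makes this product negative. -/
theorem Stable.norm_X0_le_one (hM : M.Stable) {z : ℂ} (h0 : 0 < ‖z‖)
    (h : (‖z‖ - 1) * (M.mu2 * M.c2 * ‖z‖ - M.lam2) ≤ 0) : ‖M.X0 z‖ ≤ 1 := by
  have hz := hM.mem_annulus h0 h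
  have h1 := hM.mul_norm_X0_sq_lt hz
  have h2 := norm_mul_le_of_K_eq_zero (M.K_X0 (ne_zero_of_mem_annulus hz))
  have ha := mul_mu1_c1_pos (M := M)
  set t := ‖M.X0 z‖
  have ht : 0 ≤ t := norm_nonneg _
  have h3 : (M.mu1 * M.c1 + M.lam1) * ‖z‖ ≤
      M.s * ‖z‖ - M.mu2 * M.c2 * ‖z‖ ^ 2 - M.lam2 := by unfold s; nlinarith
  by_contra! hc
  have h4 : 0 ≤ (t - 1) * (M.mu1 * M.c1 * t - M.lam1) * ‖z‖ := by
    nlinarith [mul_le_mul_of_nonneg_left h3 ht]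
  have h5 : M.mu1 * M.c1 * t < M.lam1 := by
    by_contra! hc'
    nlinarith [mul_le_mul_of_nonneg_left hc' ht, M.lam1_pos]
  nlinarith [mul_pos (mul_pos (sub_pos.2 hc) (sub_pos.2 h5)) h0]

theorem Stable.norm_X0_lt_one (hM : M.Stable) {z : ℂ} (h0 : 0 < ‖z‖)
    (h : (‖z‖ - 1) * (M.mu2 * M.c2 * ‖z‖ - M.lam2) < 0) : ‖M.X0 z‖ < 1 := by
  refine lt_of_le_of_ne (hM.norm_X0_le_one h0 h.le) fun hc => ?_
  have hz := hM.mem_annulus h0 h.le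
  have h2 := norm_mul_le_of_K_eq_zero (M.K_X0 (ne_zero_of_mem_annulus hz))
  rw [hc, s] at h2
  nlinarith

theorem X0_ne_zero {z : ℂ} (hz : z ≠ 0) : M.X0 z ≠ 0 := by
  intro h
  have h0 := M.K_X0 hz
  have h1 : (M.lam1 : ℂ) ≠ 0 := by exact_mod_cast M.lam1_pos.ne'
  simp [K, h, hz, h1] at h0

theorem sub_mul_eq_of_K_eq_zero {x z : ℂ} (h : M.K x z = 0) :
    (z - 1) * (M.lam2 - M.mu2 * M.c2 * z) * x = (1 - x) * z * (M.lam1 - M.mu1 * M.c1 * x) := by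
  simp only [K, s] at h
  push_cast at h
  linear_combination -h

theorem sub_mul_eq_of_K_eq_zero' {x z : ℂ} (h : M.K x z = 0) :
    (z - x) * (M.lam2 - M.mu2 * M.c2 * x * z) =
      z * (1 - x) * (M.lam1 + M.lam2 - (M.mu1 * M.c1 + M.mu2 * M.c2) * x) := by
  simp only [K, s] at h
  push_cast at h
  linear_combination -h

theorem Stable.sub_mul_ne_zero (hM : M.Stable) {x : ℂ} (hx : ‖x‖ ≤ 1) :
    (M.lam1 + M.lam2 - (M.mu1 * M.c1 + M.mu2 * M.c2) * x : ℂ) ≠ 0 := by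
  intro h
  have h1 : ((M.lam1 + M.lam2 : ℝ) : ℂ) = ((M.mu1 * M.c1 + M.mu2 * M.c2 : ℝ) : ℂ) * x := by
    push_cast; linear_combination h
  have h2 := congrArg norm h1
  have ha := mul_mu1_c1_pos (M := M)
  have hb := mul_mu2_c2_pos (M := M)
  rw [norm_mul, Complex.norm_real, Complex.norm_real, 
    Real.norm_of_nonneg (by linarith [M.lam1_pos, M.lam2_pos]),
    Real.norm_of_nonneg (by linarith)] at h2
  nlinarith [hM.2]

/-- The diagonal zeros of K are 0, 1 and (λ₁+λ₂)/(μ₁c₁+μ₂c₂); the last exceeds 1 by stability,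
whereas |X₀(z)| ≤ 1. So z = 1 is the only possible singularity of `ratio` on the two circles. -/
theorem Stable.eq_one_of_X0_eq (hM : M.Stable) {z : ℂ} (hz : ‖z‖ = M.r2 ∨ ‖z‖ = 1)
    (h : M.X0 z = z) : z = 1 := by
  have h0 : 0 < ‖z‖ := by rcases hz with h | h <;> rw [h] <;> simp [r2_pos]
  have hb : (‖z‖ - 1) * (M.mu2 * M.c2 * ‖z‖ - M.lam2) ≤ 0 := by
    rcases hz with h | h
    · exact r2_between h
    · simp [h]
  have hz0 := norm_pos_iff.1 h0
  have h1 := sub_mul_eq_of_K_eq_zero' (M.K_X0 hz0)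
  rw [h, sub_self, zero_mul] at h1
  have h2 := hM.sub_mul_ne_zero (hM.norm_X0_le_one h0 hb)
  rw [h] at h2
  have h3 := (mul_eq_zero.1 ((mul_eq_zero.1 h1.symm).resolve_right h2)).resolve_left hz0
  linear_combination -h3

/-- Factorization of `K(X₀(z), ·)`. -/
theorem K_X0_eq {z : ℂ} (hz : z ≠ 0) (y : ℂ) : z * M.K (M.X0 z) y =
    M.X0 z * (y - z) * (M.mu2 * M.c2 * y * z - M.lam2) := by
  have h := M.K_X0 hz
  simp only [K] at h ⊢
  linear_combination y * h

/-- The roots z and λ₂/(μ₂c₂z) of K(X₀(z), ·) both have modulus r₂. -/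
theorem K_X0_ne_zero {y z : ℂ} (hz : ‖z‖ = M.r2) (hy : ‖y‖ < M.r2) : M.K (M.X0 z) y ≠ 0 := by
  have hz0 : z ≠ 0 := norm_pos_iff.1 (hz ▸ r2_pos)
  intro h
  have h1 := K_X0_eq (M := M) hz0 y
  rw [h, mul_zero] at h1
  rcases mul_eq_zero.1 h1.symm with h2 | h2
  · rcases mul_eq_zero.1 h2 with h3 | h3
    · exact X0_ne_zero hz0 h3
    · rw [sub_eq_zero.1 h3] at hy; exact hy.ne hz
  · have h3 : ((M.mu2 * M.c2 : ℝ) : ℂ) * y * z = (M.lam2 : ℝ) := by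
      push_cast; linear_combination h2
    have h4 := congrArg norm h3
    have hb := mul_mu2_c2_pos (M := M)
    rw [norm_mul, norm_mul, Complex.norm_real, Complex.norm_real, Real.norm_of_nonneg hb.le,
      Real.norm_of_nonneg M.lam2_pos.le, hz, ← r2_sq] at h4
    nlinarith [mul_pos hb (mul_pos (r2_pos (M := M)) (sub_pos.2 hy))]

theorem conj_K (x z : ℂ) : M.K (starRingEnd ℂ x) (starRingEnd ℂ z) = starRingEnd ℂ (M.K x z) := by
  simp [K]

/-- On this circle the second root λ₂/(μ₂c₂z) of K(X₀(z), ·) is the conjugate of z. -/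
theorem Stable.X0_conj (hM : M.Stable) {z : ℂ} (hz : ‖z‖ = M.r2) :
    M.X0 (starRingEnd ℂ z) = M.X0 z := by
  have hz' : ‖starRingEnd ℂ z‖ = M.r2 := by simpa using hz
  have hz0 : z ≠ 0 := norm_pos_iff.1 (hz ▸ r2_pos)
  refine hM.eq_X0 (hM.mem_annulus_of_norm_eq_r2 hz') ?_
    (hM.mul_norm_X0_sq_lt (hM.mem_annulus_of_norm_eq_r2 hz))
  have h := K_X0_eq (M := M) hz0 (starRingEnd ℂ z)
  have h1 : (M.mu2 * M.c2 * starRingEnd ℂ z * z : ℂ) = M.lam2 := by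
    rw [mul_assoc, Complex.conj_mul', hz, ← r2_sq]
    push_cast; ring
  rw [h1, sub_self, mul_zero] at h
  exact (mul_eq_zero.1 h).resolve_left hz0

/-- `X₀` is real on the circle of radius `r₂`. -/
theorem Stable.conj_X0 (hM : M.Stable) {z : ℂ} (hz : ‖z‖ = M.r2) :
    starRingEnd ℂ (M.X0 z) = M.X0 z := by
  have hz' : ‖starRingEnd ℂ z‖ = M.r2 := by simpa using hz
  rw [← hM.X0_conj hz]
  refine (hM.eq_X0 (hM.mem_annulus_of_norm_eq_r2 hz') ?_ ?_).symm
  · rw [hM.X0_conj hz, conj_K, M.K_X0 (norm_pos_iff.1 (hz ▸ r2_pos)), map_zero]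
  · rw [hM.X0_conj hz, RCLike.norm_conj]
    exact hM.mul_norm_X0_sq_lt (hM.mem_annulus_of_norm_eq_r2 hz)

theorem norm_sub_one_le {z : ℂ} {t : ℝ} (hz : ‖z‖ = 1) (h0 : 0 ≤ t) (h1 : t ≤ 1) :
    ‖z - 1‖ ≤ 2 * ‖z - t‖ := by
  have h2 : ‖z - 1‖ ≤ ‖z - t‖ + ‖(t : ℂ) - 1‖ := norm_sub_le_norm_sub_add_norm_sub z t 1
  have h3 : ‖(t : ℂ) - 1‖ = 1 - t := by
    rw [← Complex.ofReal_one, ← Complex.ofReal_sub, Complex.norm_real, norm_sub_rev,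
      Real.norm_of_nonneg (by linarith)]
  have h4 := norm_sub_norm_le z (t : ℂ)
  rw [Complex.norm_real, Real.norm_of_nonneg h0, hz] at h4
  linarith

/-- This bounds `ratio` near its singularity when r₂ = 1. There X₀(z) is a real t ≤ 1; the real part
of K(t, z)/z = 0 rules out t < 0, and `norm_sub_one_le` applies. -/
theorem Stable.norm_sub_one_le_of_r2_eq_one (hM : M.Stable) {z : ℂ} (hr : M.r2 = 1)
    (hz : ‖z‖ = M.r2) : ‖z - 1‖ ≤ 2 * ‖z - M.X0 z‖ := by
  obtain ⟨t, ht⟩ := Complex.conj_eq_iff_real.1 (hM.conj_X0 hz)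
  have hz1 := hz.trans hr
  have h1 := hM.norm_X0_le_one (by linarith) (r2_between hz)
  have hK := M.K_X0 (y := z) (norm_pos_iff.1 (by linarith))
  rw [ht] at h1 hK ⊢
  rw [Complex.norm_real] at h1
  refine norm_sub_one_le hz1 ?_ (abs_le.1 h1).2
  have hb := mul_mu2_c2_pos (M := M)
  have ha := mul_mu1_c1_pos (M := M)
  have hzz : z * starRingEnd ℂ z = 1 := by rw [Complex.mul_conj', hz1]; simp
  have e : ((M.mu1 * M.c1 * t ^ 2 + M.lam1 - M.s * t : ℝ) : ℂ) + ((M.mu2 * M.c2 * t : ℝ) : ℂ) * z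
      + ((M.lam2 * t : ℝ) : ℂ) * starRingEnd ℂ z = 0 := by
    simp only [K] at hK
    push_cast
    linear_combination starRingEnd ℂ z * hK - (M.mu1 * M.c1 * t ^ 2 + M.lam1 - M.s * t
      + M.mu2 * M.c2 * t * z) * hzz
  have e' := congrArg Complex.re e
  simp only [Complex.add_re, Complex.ofReal_re, Complex.re_ofReal_mul, Complex.conj_re,
    Complex.zero_re] at e'
  have hre : z.re ≤ 1 := hz1 ▸ Complex.re_le_norm z
  have hpos : 0 < M.s - (M.mu2 * M.c2 + M.lam2) * z.re := by
    have := mul_le_mul_of_nonneg_left hre (add_pos hb M.lam2_pos).le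
    have := M.lam1_pos
    unfold s; linarith
  by_contra! hneg
  have := mul_pos_of_neg_of_neg hneg (neg_lt_zero.2 hpos)
  nlinarith [mul_nonneg ha.le (sq_nonneg t), M.lam1_pos]

end Model

/-! ### Cauchy integrals of power series up to the boundary of the disc. -/

theorem ae_circleMap_ne {c w : ℂ} {R : ℝ} (hR : R ≠ 0) : ∀ᵐ θ : ℝ, circleMap c R θ ≠ w :=
  ((Set.countable_singleton w).preimage_circleMap c hR).ae_notMem volume

theorem circleIntegral_congr_of_ne {f g : ℂ → ℂ} {c w : ℂ} {R : ℝ} (hR : 0 < R)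
    (h : ∀ z ∈ sphere c R, z ≠ w → f z = g z) : (∮ z in C(c, R), f z) = ∮ z in C(c, R), g z := by
  refine intervalIntegral.integral_congr_ae ?_
  filter_upwards [ae_circleMap_ne (c := c) (w := w) hR.ne'] with θ hθ _
  rw [h _ (circleMap_mem_sphere c hR.le θ) hθ]

theorem continuousOn_tsum_mul_pow {q : ℕ → ℝ} (hq : Summable q) (h0 : ∀ n, 0 ≤ q n) :
    ContinuousOn (fun z : ℂ => ∑' n, (q n : ℂ) * z ^ n) (closedBall 0 1) := by
  refine continuousOn_tsum (fun n => by fun_prop) hq fun n z hz => ?_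
  rw [norm_mul, norm_pow, Complex.norm_real, Real.norm_of_nonneg (h0 n)]
  exact mul_le_of_le_one_right (h0 n) (pow_le_one₀ (norm_nonneg _) (by simpa using hz))

theorem differentiableOn_tsum_mul_pow {q : ℕ → ℝ} (hq : Summable q) (h0 : ∀ n, 0 ≤ q n) :
    DifferentiableOn ℂ (fun z : ℂ => ∑' n, (q n : ℂ) * z ^ n) (ball 0 1) := by
  refine Complex.differentiableOn_tsum_of_summable_norm hq (fun n => by fun_prop) isOpen_ball
    fun n z hz => ?_
  rw [norm_mul, norm_pow, Complex.norm_real, Real.norm_of_nonneg (h0 n)]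
  exact mul_le_of_le_one_right (h0 n) (pow_le_one₀ (norm_nonneg _) (mem_ball_zero_iff.1 hz).le)

/-- Cauchy's formula for the coefficients of a power series, on a circle where the series is known
to converge absolutely. -/
theorem circleIntegral_mul_inv_pow {q : ℕ → ℝ} (hq : Summable q) (h0 : ∀ n, 0 ≤ q n) {ρ : ℝ}
    (hρ : 0 < ρ) (hρ1 : ρ ≤ 1) (n : ℕ) :
    (∮ z in C(0, ρ), (∑' n, (q n : ℂ) * z ^ n) * (z ^ (n + 1))⁻¹) = 2 * π * Complex.I * q n := by
  set F : ℂ → ℂ := fun z => ∑' n, (q n : ℂ) * z ^ n with hF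
  have hc : ContinuousOn F (closedBall 0 ρ) :=
    (continuousOn_tsum_mul_pow hq h0).mono (closedBall_subset_closedBall hρ1)
  have hd : DifferentiableOn ℂ F (ball 0 ρ) :=
    (differentiableOn_tsum_mul_pow hq h0).mono (ball_subset_ball hρ1)
  have h2 : (2 * π * Complex.I : ℂ) ≠ 0 := Complex.two_pi_I_ne_zero
  have hs1 : HasFPowerSeriesAt F (FormalMultilinearSeries.ofScalars ℂ (fun n => (q n : ℂ))) 0 := by
    rw [hasFPowerSeriesAt_iff]
    filter_upwards [closedBall_mem_nhds (0 : ℂ) one_pos] with z hz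
    simp only [FormalMultilinearSeries.coeff_ofScalars, zero_add, smul_eq_mul]
    simpa [mul_comm] using hasSum_of_norm_le_one hq h0 (x := z) (by simpa using hz)
  have hs2 : HasFPowerSeriesAt F (FormalMultilinearSeries.ofScalars ℂ (fun n =>
      (2 * π * Complex.I)⁻¹ * ∮ z in C(0, ρ), F z * (z ^ (n + 1))⁻¹)) 0 := by
    rw [hasFPowerSeriesAt_iff]
    filter_upwards [ball_mem_nhds (0 : ℂ) hρ] with w hw
    have h := hasSum_two_pi_I_cauchyPowerSeries_integral (f := F) (c := 0) (R := ρ) (w := w)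
      ((hc.mono sphere_subset_closedBall).circleIntegrable hρ.le) (by simpa using hw)
    rw [zero_add, Complex.circleIntegral_sub_inv_smul_of_differentiable_on_off_countable
      Set.countable_empty hw hc (fun z hz => hd.differentiableAt (isOpen_ball.mem_nhds hz.1))] at h
    have h' := h.mul_left (2 * π * Complex.I)⁻¹
    simp only [FormalMultilinearSeries.coeff_ofScalars, zero_add, smul_eq_mul] at h' ⊢
    rw [inv_mul_cancel_left₀ h2] at h'
    refine (congrArg (fun g => HasSum g (F w)) (funext fun k => ?_)).mpr h'
    rw [mul_left_comm, ← circleIntegral.integral_const_mul]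
    congr 2
    ext z
    rw [sub_zero, div_pow, pow_succ, mul_inv]
    ring
  have h3 := congrArg (fun s => s.coeff n) (hs1.eq_formalMultilinearSeries hs2)
  simp only [FormalMultilinearSeries.coeff_ofScalars] at h3
  rw [h3, mul_inv_cancel_left₀ h2]

/-! ### Continuation of P₂ to the disc of radius r₂. -/

namespace Model

variable {M : Model} {p : ℕ × ℕ → ℝ}

theorem IsStationary.continuousOn_P1 (hp : M.IsStationary p) :
    ContinuousOn (P1 p) (closedBall 0 1) :=
  continuousOn_tsum_mul_pow hp.summable_fst fun n => hp.nonneg (n, 0)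

theorem IsStationary.continuousOn_P2 (hp : M.IsStationary p) :
    ContinuousOn (P2 p) (closedBall 0 1) :=
  continuousOn_tsum_mul_pow hp.summable_snd fun n => hp.nonneg (0, n)

theorem IsStationary.differentiableOn_P1 (hp : M.IsStationary p) :
    DifferentiableOn ℂ (P1 p) (ball 0 1) :=
  differentiableOn_tsum_mul_pow hp.summable_fst fun n => hp.nonneg (n, 0)

theorem IsStationary.differentiableOn_P2 (hp : M.IsStationary p) :
    DifferentiableOn ℂ (P2 p) (ball 0 1) :=
  differentiableOn_tsum_mul_pow hp.summable_snd fun n => hp.nonneg (0, n)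

theorem differentiable_P2minus : Differentiable ℂ (M.P2minus p) := by
  unfold P2minus
  fun_prop

/-- The coefficient in the relation between `P₂(z)` and `P₁(X₀(z))`. -/
def ratio (M : Model) (z : ℂ) : ℂ := (z - 1) * M.X0 z / (z - M.X0 z)

/-- The analytic continuation of `P₂` provided by the functional equation. -/
def continuation (M : Model) (p : ℕ × ℕ → ℝ) (z : ℂ) : ℂ :=
  M.ratio z * (M.lam2 / M.lam1 * P1 p (M.X0 z) + M.P2minus p z)

theorem IsStationary.P2_eq (hp : M.IsStationary p) {z : ℂ} (hz : ‖z‖ ≤ 1) (h0 : z ≠ 0)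
    (hX : ‖M.X0 z‖ ≤ 1) (hne : M.X0 z ≠ z) : P2 p z = M.continuation p z := by
  have h := hp.functional_eq hX hz
  rw [M.K_X0 h0, zero_mul] at h
  have h1 : (M.lam1 : ℂ) ≠ 0 := by exact_mod_cast M.lam1_pos.ne'
  have h2 : z - M.X0 z ≠ 0 := sub_ne_zero.2 hne.symm
  rw [continuation, ratio]
  field_simp
  linear_combination -h

/-- The two factored forms of K = 0 share the factor z(1 - X₀(z)); eliminating it yields an
expression regular at z = 1 when λ₂ ≠ μ₂c₂. -/
theorem ratio_eq {z : ℂ} (h0 : z ≠ 0) (hne : M.X0 z ≠ z)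
    (h1 : (M.lam2 - M.mu2 * M.c2 * z : ℂ) ≠ 0)
    (h2 : (M.lam1 + M.lam2 - (M.mu1 * M.c1 + M.mu2 * M.c2) * M.X0 z : ℂ) ≠ 0) :
    M.ratio z = (M.lam2 - M.mu2 * M.c2 * M.X0 z * z) * (M.lam1 - M.mu1 * M.c1 * M.X0 z) /
      ((M.lam2 - M.mu2 * M.c2 * z) *
        (M.lam1 + M.lam2 - (M.mu1 * M.c1 + M.mu2 * M.c2) * M.X0 z)) := by
  have e1 := sub_mul_eq_of_K_eq_zero (M.K_X0 h0)
  have e2 := sub_mul_eq_of_K_eq_zero' (M.K_X0 h0)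
  rw [ratio, div_eq_div_iff (sub_ne_zero.2 hne.symm) (mul_ne_zero h1 h2)]
  linear_combination (M.lam1 + M.lam2 - (M.mu1 * M.c1 + M.mu2 * M.c2) * M.X0 z : ℂ) * e1
    - (M.lam1 - M.mu1 * M.c1 * M.X0 z) * e2

theorem Stable.continuousOn_ratio (hM : M.Stable) :
    ContinuousOn M.ratio (sphere 0 M.r2 \ {1}) := by
  intro z hz
  have hz' : ‖z‖ = M.r2 := by simpa using hz.1
  have hX : ContinuousAt M.X0 z :=
    (differentiableAt_X0 (hM.mem_annulus_of_norm_eq_r2 hz')).continuousAt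
  have hne : z - M.X0 z ≠ 0 := fun h =>
    hz.2 (hM.eq_one_of_X0_eq (Or.inl hz') (sub_eq_zero.1 h).symm)
  refine ContinuousAt.continuousWithinAt ?_
  unfold ratio
  exact ContinuousAt.div (by fun_prop) (by fun_prop) hne

theorem Stable.exists_norm_ratio_le (hM : M.Stable) :
    ∃ C, ∀ z ∈ sphere (0 : ℂ) M.r2, ‖M.ratio z‖ ≤ C := by
  by_cases h : M.r2 = 1
  · refine ⟨2, fun z hz => ?_⟩
    have hz' : ‖z‖ = M.r2 := by simpa using hz
    have hX : ‖M.X0 z‖ ≤ 1 := hM.norm_X0_le_one (hz' ▸ r2_pos) (r2_between hz')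
    by_cases hne : z - M.X0 z = 0
    · simp [ratio, hne]
    rw [ratio, norm_div, norm_mul, div_le_iff₀ (norm_pos_iff.2 hne)]
    calc ‖z - 1‖ * ‖M.X0 z‖ ≤ ‖z - 1‖ * 1 := mul_le_mul_of_nonneg_left hX (norm_nonneg _)
      _ ≤ _ := by rw [mul_one]; exact hM.norm_sub_one_le_of_r2_eq_one h hz'
  · have hc : ContinuousOn M.ratio (sphere 0 M.r2) := by
      have := hM.continuousOn_ratio
      rwa [Set.sdiff_singleton_eq_self] at this
      simpa using fun h' => h h'.symm
    exact (isCompact_sphere _ _).exists_bound_of_continuousOn hc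

theorem measurable_X0 : Measurable M.X0 := by
  unfold X0 sigma1
  fun_prop

theorem Stable.circleIntegrable_ratio (hM : M.Stable) : CircleIntegrable M.ratio 0 M.r2 := by
  obtain ⟨C, hC⟩ := hM.exists_norm_ratio_le
  have hm : Measurable M.ratio := by
    unfold ratio
    have := measurable_X0 (M := M)
    fun_prop
  rw [CircleIntegrable, intervalIntegrable_iff]
  exact Measure.integrableOn_of_bounded (by simp [ENNReal.mul_eq_top])
    (hm.comp (measurable_circleMap _ _)).aestronglyMeasurable
    (Filter.Eventually.of_forall fun θ => hC _ (circleMap_mem_sphere _ r2_pos.le θ))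

theorem Stable.continuousOn_P1_X0 (hM : M.Stable) (hp : M.IsStationary p) :
    ContinuousOn (fun z => P1 p (M.X0 z)) (sphere 0 M.r2) := by
  refine hp.continuousOn_P1.comp (continuousOn_X0.mono fun z hz => ?_) fun z hz => ?_
  · exact hM.mem_annulus_of_norm_eq_r2 (by simpa using hz)
  · have hz' : ‖z‖ = M.r2 := by simpa using hz
    simpa using hM.norm_X0_le_one (hz' ▸ r2_pos) (r2_between hz')

theorem Stable.circleIntegrable_continuation (hM : M.Stable) (hp : M.IsStationary p) :
    CircleIntegrable (M.continuation p) 0 M.r2 := by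
  refine hM.circleIntegrable_ratio.mul_continuousOn (g := fun z =>
    M.lam2 / M.lam1 * P1 p (M.X0 z) + M.P2minus p z) ?_
  rw [abs_of_pos r2_pos]
  exact (continuousOn_const.mul (hM.continuousOn_P1_X0 hp)).add
    differentiable_P2minus.continuous.continuousOn

/-- If r₂ ≤ 1, the integrands agree off z = 1. If r₂ > 1, |X₀| < 1 for 1 < |z| < r₂, so P₁ ∘ X₀ is
analytic there and the contour can be shrunk to the unit circle. -/
theorem Stable.circleIntegral_continuation_mul (hM : M.Stable) (hp : M.IsStationary p) {φ : ℂ → ℂ}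
    (hc : ContinuousOn φ (closedBall 0 M.r2 \ {0}))
    (hd : DifferentiableOn ℂ φ (ball 0 M.r2 \ {0})) :
    (∮ z in C(0, M.r2), M.continuation p z * φ z) = ∮ z in C(0, min 1 M.r2), P2 p z * φ z := by
  rcases le_or_gt M.r2 1 with h | h
  · rw [min_eq_right h]
    refine circleIntegral_congr_of_ne r2_pos (w := 1) fun z hz hz1 => ?_
    have hz' : ‖z‖ = M.r2 := by simpa using hz
    rw [hp.P2_eq (hz' ▸ h) (norm_pos_iff.1 (hz' ▸ r2_pos))
      (hM.norm_X0_le_one (hz' ▸ r2_pos) (r2_between hz'))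
      fun h => hz1 (hM.eq_one_of_X0_eq (Or.inl hz') h)]
  · rw [min_eq_left h.le]
    have hb := mul_mu2_c2_pos (M := M)
    have hr := M.r2_sq
    -- `R` is `continuation` with its singularity removed. Agreement is needed only on the two
    -- bounding circles, so nothing has to be shown about X₀(z) = z in between.
    set R : ℂ → ℂ := fun z =>
      (M.lam2 - M.mu2 * M.c2 * M.X0 z * z) * (M.lam1 - M.mu1 * M.c1 * M.X0 z) /
        ((M.lam2 - M.mu2 * M.c2 * z) *
        (M.lam1 + M.lam2 - (M.mu1 * M.c1 + M.mu2 * M.c2) * M.X0 z)) *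
        (M.lam2 / M.lam1 * P1 p (M.X0 z) + M.P2minus p z) with hR
    have hbt : ∀ z : ℂ, 1 ≤ ‖z‖ → ‖z‖ ≤ M.r2 → M.mu2 * M.c2 * ‖z‖ < M.lam2 := by
      intro z h1 h2
      rw [← hr]
      nlinarith [mul_pos hb (mul_pos (r2_pos (M := M)) (sub_pos.2 h)),
        mul_le_mul_of_nonneg_left h2 hb.le]
    have hle : ∀ z : ℂ, 1 ≤ ‖z‖ → ‖z‖ ≤ M.r2 →
        (‖z‖ - 1) * (M.mu2 * M.c2 * ‖z‖ - M.lam2) ≤ 0 := fun z h1 h2 =>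
      mul_nonpos_of_nonneg_of_nonpos (by linarith) (by linarith [hbt z h1 h2])
    have hX1 : ∀ z : ℂ, 1 ≤ ‖z‖ → ‖z‖ ≤ M.r2 → ‖M.X0 z‖ ≤ 1 := fun z h1 h2 =>
      hM.norm_X0_le_one (by linarith) (hle z h1 h2)
    have hann : ∀ z : ℂ, 1 ≤ ‖z‖ → ‖z‖ ≤ M.r2 → z ∈ M.annulus := fun z h1 h2 =>
      hM.mem_annulus (by linarith) (hle z h1 h2)
    have hn1 : ∀ z : ℂ, 1 ≤ ‖z‖ → ‖z‖ ≤ M.r2 → (M.lam2 - M.mu2 * M.c2 * z : ℂ) ≠ 0 := by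
      intro z h1 h2 h3
      have h4 : (M.lam2 : ℂ) = ((M.mu2 * M.c2 : ℝ) : ℂ) * z := by
        push_cast; linear_combination h3
      have h5 := congrArg norm h4
      rw [norm_mul, Complex.norm_real, Complex.norm_real, Real.norm_of_nonneg M.lam2_pos.le,
        Real.norm_of_nonneg hb.le] at h5
      linarith [hbt z h1 h2]
    have hn2 := fun (z : ℂ) (h1 : 1 ≤ ‖z‖) (h2 : ‖z‖ ≤ M.r2) => hM.sub_mul_ne_zero (hX1 z h1 h2)
    have heq : ∀ z : ℂ, (‖z‖ = M.r2 ∨ ‖z‖ = 1) → z ≠ 1 → M.continuation p z = R z := by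
      intro z hz hz1
      have h1 : 1 ≤ ‖z‖ := by rcases hz with h | h <;> linarith
      have h2 : ‖z‖ ≤ M.r2 := by rcases hz with h | h <;> linarith
      rw [continuation, ratio_eq (norm_pos_iff.1 (by linarith))
        (fun h => hz1 (hM.eq_one_of_X0_eq hz h)) (hn1 z h1 h2) (hn2 z h1 h2)]
    have hRc : ContinuousOn R (closedBall 0 M.r2 \ ball 0 1) := by
      have hXc : ContinuousOn M.X0 (closedBall 0 M.r2 \ ball 0 1) :=
        continuousOn_X0.mono fun z hz =>
          hann z (by simpa using hz.2) (by simpa using hz.1)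
      have hPc : ContinuousOn (fun z => P1 p (M.X0 z)) (closedBall 0 M.r2 \ ball 0 1) :=
        hp.continuousOn_P1.comp hXc fun z hz => by
          simpa using hX1 z (by simpa using hz.2) (by simpa using hz.1)
      have hm := differentiable_P2minus (M := M) (p := p) |>.continuous
      refine ContinuousOn.mul (ContinuousOn.div (by fun_prop) (by fun_prop) fun z hz => ?_)
        (by fun_prop)
      exact mul_ne_zero (hn1 z (by simpa using hz.2) (by simpa using hz.1))
        (hn2 z (by simpa using hz.2) (by simpa using hz.1))
    have hRd : ∀ z ∈ ball (0 : ℂ) M.r2 \ closedBall 0 1, DifferentiableAt ℂ R z := by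
      intro z hz
      have h1 : 1 < ‖z‖ := by simpa using hz.2
      have h2 : ‖z‖ < M.r2 := by simpa using hz.1
      have hXd := differentiableAt_X0 (hann z h1.le h2.le)
      have hlt : ‖M.X0 z‖ < 1 := hM.norm_X0_lt_one (by linarith)
        (mul_neg_of_pos_of_neg (by linarith) (by linarith [hbt z h1.le h2.le]))
      have hP : DifferentiableAt ℂ (fun z => P1 p (M.X0 z)) z :=
        (hp.differentiableOn_P1.differentiableAt
          (isOpen_ball.mem_nhds (by simpa using hlt))).comp z hXd
      have hm := (differentiable_P2minus (M := M) (p := p)) z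
      exact DifferentiableAt.mul (DifferentiableAt.div (by fun_prop) (by fun_prop)
        (mul_ne_zero (hn1 z h1.le h2.le) (hn2 z h1.le h2.le))) (by fun_prop)
    calc (∮ z in C(0, M.r2), M.continuation p z * φ z) = ∮ z in C(0, M.r2), R z * φ z :=
          circleIntegral_congr_of_ne r2_pos (w := 1) fun z hz hz1 => by
            rw [heq z (Or.inl (by simpa using hz)) hz1]
      _ = ∮ z in C(0, 1), R z * φ z := by
          refine Complex.circleIntegral_eq_of_differentiable_on_annulus_off_countable one_pos h.le
            Set.countable_empty (hRc.mul (hc.mono ?_)) fun z hz => (hRd z hz.1).mul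
              (hd.differentiableAt ?_)
          · exact fun z hz => ⟨hz.1, fun h0 => hz.2 (by simp [Set.mem_singleton_iff.1 h0])⟩
          · refine (isOpen_ball.sdiff isClosed_singleton).mem_nhds ⟨hz.1.1, fun h0 => hz.1.2 ?_⟩
            simp [Set.mem_singleton_iff.1 h0]
      _ = ∮ z in C(0, 1), P2 p z * φ z :=
          circleIntegral_congr_of_ne one_pos (w := 1) fun z hz hz1 => by
            have hz' : ‖z‖ = 1 := by simpa using hz
            rw [← heq z (Or.inr hz') hz1, hp.P2_eq hz'.le (norm_pos_iff.1 (by linarith))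
              (hX1 z hz'.ge (by linarith)) fun h => hz1 (hM.eq_one_of_X0_eq (Or.inr hz') h)]

/-- Cauchy's formula for the power series coefficients of `P₂` on the circle of radius `r₂`. -/
theorem Stable.hasSum_P2 (hM : M.Stable) (hp : M.IsStationary p) {y : ℂ} (hy : ‖y‖ < M.r2) :
    HasSum (fun n : ℕ => (p (0, n) : ℂ) * y ^ n)
      ((2 * π * Complex.I)⁻¹ * ∮ z in C(0, M.r2), M.continuation p z * (z - y)⁻¹) := by
  have h := hasSum_two_pi_I_cauchyPowerSeries_integral (hM.circleIntegrable_continuation hp) hy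
  -- The Cauchy series of any integrable function on the circle converges for |y| < r₂. Matching
  -- coefficients therefore gives convergence of P₂ as well as its value.
  have e : (fun n : ℕ => (p (0, n) : ℂ) * y ^ n) = fun n => (2 * π * Complex.I)⁻¹ *
      ∮ z in C(0, M.r2), (y / (z - 0)) ^ n • (z - 0)⁻¹ • M.continuation p z := by
    ext n
    have h1 := hM.circleIntegral_continuation_mul hp (φ := fun z => (z ^ (n + 1))⁻¹)
      (ContinuousOn.inv₀ (by fun_prop) fun z hz => pow_ne_zero _ hz.2)
      (DifferentiableOn.inv (by fun_prop) fun z hz => pow_ne_zero _ hz.2)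
    have h2 := circleIntegral_mul_inv_pow hp.summable_snd (fun n => hp.nonneg (0, n))
      (lt_min one_pos (r2_pos (M := M))) (min_le_left _ _) n
    rw [show (∮ z in C(0, M.r2), (y / (z - 0)) ^ n • (z - 0)⁻¹ • M.continuation p z) =
      y ^ n * ∮ z in C(0, M.r2), M.continuation p z * (z ^ (n + 1))⁻¹ from ?_, h1]
    · unfold P2
      rw [h2, mul_left_comm, inv_mul_cancel_left₀ Complex.two_pi_I_ne_zero, mul_comm]
    · rw [← circleIntegral.integral_const_mul]
      congr 1
      ext z
      rw [sub_zero, div_pow, pow_succ, mul_inv, smul_eq_mul, smul_eq_mul]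
      ring
  rw [e]
  simpa [mul_comm (M.continuation p _)] using h.mul_left (2 * π * Complex.I)⁻¹

/-- The pole r₂²/y lies outside the closed disc; after moving to the circle of radius min(1, r₂),
Cauchy's theorem applies to P₂ itself. -/
theorem Stable.circleIntegral_continuation_mul_inv (hM : M.Stable) (hp : M.IsStationary p) {y : ℂ}
    (hy : ‖y‖ < M.r2) : (∮ z in C(0, M.r2), M.continuation p z *
      (M.lam2 - M.mu2 * M.c2 * y * z)⁻¹) = 0 := by
  have hb := mul_mu2_c2_pos (M := M)
  have hr := M.r2_sq
  have hne : ∀ z ∈ closedBall (0 : ℂ) M.r2, (M.lam2 - M.mu2 * M.c2 * y * z : ℂ) ≠ 0 := by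
    intro z hz h3
    have hz' : ‖z‖ ≤ M.r2 := by simpa using hz
    have h4 : (M.lam2 : ℂ) = ((M.mu2 * M.c2 : ℝ) : ℂ) * y * z := by
      push_cast; linear_combination h3
    have h5 := congrArg norm h4
    rw [norm_mul, norm_mul, Complex.norm_real, Complex.norm_real,
      Real.norm_of_nonneg M.lam2_pos.le, Real.norm_of_nonneg hb.le, ← hr] at h5
    have h6 : ‖y‖ * ‖z‖ < M.r2 ^ 2 := by
      nlinarith [norm_nonneg y, norm_nonneg z, r2_pos (M := M)]
    nlinarith
  have hc : ContinuousOn (fun z : ℂ => (M.lam2 - M.mu2 * M.c2 * y * z : ℂ)⁻¹)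
      (closedBall 0 M.r2) := ContinuousOn.inv₀ (by fun_prop) hne
  have hd : DifferentiableOn ℂ (fun z : ℂ => (M.lam2 - M.mu2 * M.c2 * y * z : ℂ)⁻¹)
      (ball 0 M.r2) :=
    DifferentiableOn.inv (by fun_prop) fun z hz => hne z (ball_subset_closedBall hz)
  rw [hM.circleIntegral_continuation_mul hp (hc.mono Set.sdiff_subset) (hd.mono Set.sdiff_subset)]
  refine Complex.circleIntegral_eq_zero_of_differentiable_on_off_countable
    (lt_min one_pos (r2_pos (M := M))).le Set.countable_empty
    ((hp.continuousOn_P2.mono (closedBall_subset_closedBall (min_le_left _ _))).mul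
      (hc.mono (closedBall_subset_closedBall (min_le_right _ _)))) fun z hz => ?_
  exact (hp.differentiableOn_P2.differentiableAt (isOpen_ball.mem_nhds
    (ball_subset_ball (min_le_left _ _) hz.1))).mul (hd.differentiableAt
      (isOpen_ball.mem_nhds (ball_subset_ball (min_le_right _ _) hz.1)))

end Model

/-! ### Folding the circle under conjugation. -/

theorem circleMap_two_pi_sub (R θ : ℝ) :
    circleMap 0 R (2 * π - θ) = starRingEnd ℂ (circleMap 0 R θ) := by
  rw [circleMap_zero, circleMap_zero, map_mul, ← Complex.exp_conj, Complex.conj_ofReal]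
  congr 1
  rw [Complex.exp_eq_exp_iff_exists_int]
  exact ⟨1, by simp; ring⟩

theorem circleIntegral_eq_integral_zero_pi {f : ℂ → ℂ} {R : ℝ} (hf : CircleIntegrable f 0 R) :
    IntervalIntegrable (fun θ => Complex.I * (circleMap 0 R θ * f (circleMap 0 R θ)
      + starRingEnd ℂ (circleMap 0 R θ) * f (starRingEnd ℂ (circleMap 0 R θ)))) volume 0 π ∧
    (∮ z in C(0, R), f z) = ∫ θ in (0)..π, Complex.I * (circleMap 0 R θ * f (circleMap 0 R θ)
      + starRingEnd ℂ (circleMap 0 R θ) * f (starRingEnd ℂ (circleMap 0 R θ))) := by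
  set g : ℝ → ℂ := fun θ => Complex.I * (circleMap 0 R θ * f (circleMap 0 R θ)) with hg
  have hi : IntervalIntegrable g volume 0 (2 * π) := by
    have h : IntervalIntegrable (fun θ => f (circleMap 0 R θ)) volume 0 (2 * π) := hf
    exact (h.continuousOn_mul (continuous_circleMap 0 R).continuousOn).const_mul _
  have h1 : IntervalIntegrable g volume 0 π := hi.mono_set (by
    rw [Set.uIcc_of_le Real.pi_pos.le, Set.uIcc_of_le Real.two_pi_pos.le]
    exact Set.Icc_subset_Icc_right (by linarith [Real.pi_pos]))
  have h2 : IntervalIntegrable g volume π (2 * π) := hi.mono_set (by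
    rw [Set.uIcc_of_le (by linarith [Real.pi_pos]), Set.uIcc_of_le Real.two_pi_pos.le]
    exact Set.Icc_subset_Icc_left Real.pi_pos.le)
  have h3 : IntervalIntegrable (fun θ => g (2 * π - θ)) volume 0 π := by
    have := (h2.comp_sub_left (2 * π)).symm
    rwa [sub_self, show 2 * π - π = π by ring] at this
  have e1 : (∮ z in C(0, R), f z) = ∫ θ in (0)..2 * π, g θ := by
    refine intervalIntegral.integral_congr fun θ _ => ?_
    simp only [hg, deriv_circleMap, smul_eq_mul]
    ring
  have e2 : ∫ θ in π..2 * π, g θ = ∫ θ in (0)..π, g (2 * π - θ) := by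
    rw [intervalIntegral.integral_comp_sub_left, sub_zero, show 2 * π - π = π by ring]
  rw [e1, ← intervalIntegral.integral_add_adjacent_intervals h1 h2, e2,
    ← intervalIntegral.integral_add h1 h3]
  have e3 : (fun θ => g θ + g (2 * π - θ)) = fun θ =>
      Complex.I * (circleMap 0 R θ * f (circleMap 0 R θ)
        + starRingEnd ℂ (circleMap 0 R θ) * f (starRingEnd ℂ (circleMap 0 R θ))) := by
    ext θ
    simp only [hg, circleMap_two_pi_sub]
    ring
  rw [← e3]
  exact ⟨h1.add h3, rfl⟩

theorem sub_rootLo_mul_sub_rootHi {A b c : ℝ} (hA : 0 < A) (h : 4 * A * c ≤ b ^ 2) (x : ℝ) :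
    A * ((x - rootLo A b c) * (x - rootHi A b c)) = A * x ^ 2 - b * x + c := by
  have := root_factor hA h x
  rw [← mul_assoc]
  exact_mod_cast this.symm

theorem rootLo_le_rootHi {A b c : ℝ} (hA : 0 < A) : rootLo A b c ≤ rootHi A b c := by
  unfold rootLo rootHi
  gcongr
  linarith [Real.sqrt_nonneg (b ^ 2 - 4 * A * c)]

/-! ### The interval [x₁, x₂] as a parameter of the half-circle. -/

namespace Model

variable {M : Model} {p : ℕ × ℕ → ℝ}

theorem sqrt_eq_mul_r2 : √(M.mu2 * M.c2 * M.lam2) = M.mu2 * M.c2 * M.r2 := by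
  rw [← M.r2_sq, show M.mu2 * M.c2 * (M.mu2 * M.c2 * M.r2 ^ 2) = (M.mu2 * M.c2 * M.r2) ^ 2 by ring,
    Real.sqrt_sq (mul_pos mul_mu2_c2_pos r2_pos).le]

theorem two_mul_r2_le : 2 * (M.mu2 * M.c2 * M.r2) ≤ M.mu2 * M.c2 + M.lam2 := by
  nlinarith [mul_nonneg (mul_mu2_c2_pos (M := M)).le (sq_nonneg (M.r2 - 1)), M.r2_sq]

theorem discrim_nonneg : 0 < M.s - 2 * (M.mu2 * M.c2 * M.r2) ∧
    4 * (M.mu1 * M.c1) * M.lam1 ≤ (M.s - 2 * (M.mu2 * M.c2 * M.r2)) ^ 2 ∧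
    4 * (M.mu1 * M.c1) * M.lam1 ≤ (M.s + 2 * (M.mu2 * M.c2 * M.r2)) ^ 2 := by
  have ha := mul_mu1_c1_pos (M := M)
  have h1 := M.lam1_pos
  have h2 := two_mul_r2_le (M := M)
  have h3 := mul_pos (mul_mu2_c2_pos (M := M)) (r2_pos (M := M))
  have h4 : M.mu1 * M.c1 + M.lam1 ≤ M.s - 2 * (M.mu2 * M.c2 * M.r2) := by unfold s; linarith
  refine ⟨by linarith, ?_, ?_⟩ <;>
  nlinarith [sq_nonneg (M.mu1 * M.c1 - M.lam1)]

theorem x1_pos : 0 < M.x1 := by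
  have h := (discrim_nonneg (M := M)).1
  have h3 := mul_pos (mul_mu2_c2_pos (M := M)) (r2_pos (M := M))
  rw [x1, sqrt_eq_mul_r2]
  exact rootLo_pos mul_mu1_c1_pos (by linarith) M.lam1_pos

theorem x1_lt_x2 : M.x1 < M.x2 := by
  obtain ⟨h, h1, h2⟩ := discrim_nonneg (M := M)
  have h3 := mul_pos (mul_mu2_c2_pos (M := M)) (r2_pos (M := M))
  rw [x1, x2, sqrt_eq_mul_r2]
  exact rootLo_lt mul_mu1_c1_pos h M.lam1_pos (by linarith) h1

/-- The quadratic with smaller root x₂ takes the value 2μ₂c₂r₂ - μ₂c₂ - λ₂ ≤ 0 at 1. -/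
theorem x2_le_one : M.x2 ≤ 1 := by
  obtain ⟨h, h1, h2⟩ := discrim_nonneg (M := M)
  have ha := mul_mu1_c1_pos (M := M)
  have e := sub_rootLo_mul_sub_rootHi ha h1 1
  have h3 := rootLo_le_rootHi (b := M.s - 2 * (M.mu2 * M.c2 * M.r2)) (c := M.lam1) ha
  have h4 := two_mul_r2_le (M := M)
  rw [x2, sqrt_eq_mul_r2]
  by_contra! hc
  have h5 := mul_pos ha (mul_pos_of_neg_of_neg (sub_neg.2 hc) (sub_neg.2 (hc.trans_le h3)))
  rw [e, s] at h5
  linarith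

/-- The cosine of the argument of the two roots of `K(x, ·)` when these lie on the circle of
radius `r₂`. -/
def cosArg (M : Model) (x : ℝ) : ℝ :=
  (M.s * x - M.mu1 * M.c1 * x ^ 2 - M.lam1) / (2 * (M.mu2 * M.c2 * M.r2) * x)

theorem cosArg_x1 : M.cosArg M.x1 = -1 := by
  obtain ⟨h, h1, h2⟩ := discrim_nonneg (M := M)
  have h3 := mul_pos (mul_mu2_c2_pos (M := M)) (r2_pos (M := M))
  have e := sub_rootLo_mul_sub_rootHi mul_mu1_c1_pos h2 M.x1
  rw [show rootLo (M.mu1 * M.c1) (M.s + 2 * (M.mu2 * M.c2 * M.r2)) M.lam1 = M.x1 by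
    rw [x1, sqrt_eq_mul_r2], sub_self, zero_mul, mul_zero] at e
  rw [cosArg, div_eq_iff (mul_pos (by linarith) x1_pos).ne']
  linarith

theorem cosArg_x2 : M.cosArg M.x2 = 1 := by
  obtain ⟨h, h1, h2⟩ := discrim_nonneg (M := M)
  have h3 := mul_pos (mul_mu2_c2_pos (M := M)) (r2_pos (M := M))
  have e := sub_rootLo_mul_sub_rootHi mul_mu1_c1_pos h1 M.x2
  rw [show rootLo (M.mu1 * M.c1) (M.s - 2 * (M.mu2 * M.c2 * M.r2)) M.lam1 = M.x2 by
    rw [x2, sqrt_eq_mul_r2], sub_self, zero_mul, mul_zero] at e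
  rw [cosArg, div_eq_iff (mul_pos (by linarith) (x1_pos.trans x1_lt_x2)).ne']
  linarith

theorem cosArg_mem_Ioo {x : ℝ} (hx : x ∈ Set.Ioo M.x1 M.x2) : M.cosArg x ∈ Set.Ioo (-1) 1 := by
  obtain ⟨h, h1, h2⟩ := discrim_nonneg (M := M)
  have ha := mul_mu1_c1_pos (M := M)
  have h3 := mul_pos (mul_mu2_c2_pos (M := M)) (r2_pos (M := M))
  have hx0 : 0 < x := x1_pos.trans hx.1
  have h4 := rootLo_le_rootHi (b := M.s - 2 * (M.mu2 * M.c2 * M.r2)) (c := M.lam1) ha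
  have h5 := rootHi_lt (c := M.lam1) ha h
    (by linarith : _ < M.s + 2 * (M.mu2 * M.c2 * M.r2))
  have e1 := sub_rootLo_mul_sub_rootHi ha h1 x
  have e2 := sub_rootLo_mul_sub_rootHi ha h2 x
  have hx' := hx
  rw [x1, x2, sqrt_eq_mul_r2] at hx'
  have p1 := mul_pos ha (mul_pos_of_neg_of_neg (sub_neg.2 hx'.2) (sub_neg.2 (hx'.2.trans_le h4)))
  have p2 := mul_neg_of_pos_of_neg ha (mul_neg_of_pos_of_neg (sub_pos.2 hx'.1)
    (sub_neg.2 (hx'.2.trans_le (h4.trans h5.le))))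
  have hd : 0 < 2 * (M.mu2 * M.c2 * M.r2) * x := mul_pos (by linarith) hx0
  constructor
  · rw [cosArg, lt_div_iff₀ hd]; linarith
  · rw [cosArg, div_lt_one hd]; linarith

theorem one_sub_cosArg_sq {x : ℝ} (hx : 0 < x) :
    1 - M.cosArg x ^ 2 = -M.Delta2 x / (2 * (M.mu2 * M.c2 * M.r2) * x) ^ 2 := by
  have h3 := mul_pos (mul_mu2_c2_pos (M := M)) (r2_pos (M := M))
  have hd : 2 * (M.mu2 * M.c2 * M.r2) * x ≠ 0 := (mul_pos (by linarith) hx).ne'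
  rw [cosArg, div_pow, eq_div_iff (pow_ne_zero 2 hd), sub_mul, div_mul_cancel₀ _ (pow_ne_zero 2 hd),
    Delta2]
  linear_combination 4 * (M.mu2 * M.c2) * x ^ 2 * M.r2_sq

theorem Delta2_neg {x : ℝ} (hx : x ∈ Set.Ioo M.x1 M.x2) : 0 < -M.Delta2 x := by
  have hx0 : 0 < x := x1_pos.trans hx.1
  have h := cosArg_mem_Ioo hx
  have h1 : 0 < 1 - M.cosArg x ^ 2 := by nlinarith [h.1, h.2]
  have h3 := mul_pos (mul_mu2_c2_pos (M := M)) (r2_pos (M := M))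
  rw [one_sub_cosArg_sq hx0] at h1
  exact (div_pos_iff_of_pos_right (pow_pos (mul_pos (by linarith) hx0) 2)).1 h1

theorem hasDerivAt_arccos_cosArg {x : ℝ} (hx : x ∈ Set.Ioo M.x1 M.x2) :
    HasDerivAt (fun x => Real.arccos (M.cosArg x))
      (-((M.lam1 - M.mu1 * M.c1 * x ^ 2) / (x * √(-M.Delta2 x)))) x := by
  have hx0 : 0 < x := x1_pos.trans hx.1
  have h3 := mul_pos (mul_mu2_c2_pos (M := M)) (r2_pos (M := M))
  have hd : 0 < 2 * (M.mu2 * M.c2 * M.r2) * x := mul_pos (by linarith) hx0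
  have hc := cosArg_mem_Ioo hx
  have h1 : HasDerivAt M.cosArg ((M.lam1 - M.mu1 * M.c1 * x ^ 2) /
      (2 * (M.mu2 * M.c2 * M.r2) * x ^ 2)) x := by
    have hn : HasDerivAt (fun x => M.s * x - M.mu1 * M.c1 * x ^ 2 - M.lam1)
        (M.s - M.mu1 * M.c1 * (2 * x)) x := by
      have := (((hasDerivAt_id x).const_mul M.s).sub
        (((hasDerivAt_id x).pow 2).const_mul (M.mu1 * M.c1))).sub_const M.lam1
      simpa using this
    have hm : HasDerivAt (fun x => 2 * (M.mu2 * M.c2 * M.r2) * x)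
        (2 * (M.mu2 * M.c2 * M.r2)) x := by
      simpa using (hasDerivAt_id x).const_mul (2 * (M.mu2 * M.c2 * M.r2))
    refine (hn.div hm hd.ne').congr_deriv ?_
    rw [div_eq_div_iff (pow_ne_zero 2 hd.ne') (mul_pos (by linarith) (pow_pos hx0 2)).ne']
    ring
  refine ((Real.hasDerivAt_arccos hc.1.ne' hc.2.ne).comp x h1).congr_deriv ?_
  have hs : 0 < √(-M.Delta2 x) := Real.sqrt_pos.2 (Delta2_neg hx)
  rw [one_sub_cosArg_sq hx0, Real.sqrt_div' _ (by positivity), Real.sqrt_sq hd.le]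
  generalize M.mu2 * M.c2 * M.r2 = q at h3
  field_simp

theorem continuousOn_arccos_cosArg :
    ContinuousOn (fun x => Real.arccos (M.cosArg x)) (Set.Icc M.x1 M.x2) := by
  refine Real.continuous_arccos.comp_continuousOn ?_
  unfold cosArg
  refine ContinuousOn.div (by fun_prop) (by fun_prop) fun x hx => ?_
  have h3 := mul_pos (mul_mu2_c2_pos (M := M)) (r2_pos (M := M))
  exact (mul_pos (by linarith) (x1_pos.trans_le hx.1)).ne'

/-- The weight multiplying `X₀(z) (z - 1) / (z - X₀(z))` in the contour integral. -/
def weight (M : Model) (y z : ℂ) : ℂ :=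
  (M.lam2 - M.mu2 * M.c2 * z ^ 2) / (z * (z - y) * (M.lam2 - M.mu2 * M.c2 * y * z))

theorem lam2_sub_mul_ne_zero {y z : ℂ} (hy : ‖y‖ < M.r2) (hz : ‖z‖ = M.r2) :
    (M.lam2 - M.mu2 * M.c2 * y * z : ℂ) ≠ 0 := by
  have hz0 : z ≠ 0 := norm_pos_iff.1 (hz ▸ r2_pos)
  intro h
  have h1 := K_X0_eq (M := M) hz0 y
  rw [show (M.mu2 * M.c2 * y * z - M.lam2 : ℂ) = 0 by linear_combination -h, mul_zero] at h1
  exact (mul_ne_zero hz0 (K_X0_ne_zero hz hy)) h1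

theorem sub_ne_zero_of_norm {y z : ℂ} (hy : ‖y‖ < M.r2) (hz : ‖z‖ = M.r2) : z - y ≠ 0 := by
  intro h
  rw [sub_eq_zero.1 h] at hz
  exact hy.ne hz

theorem continuousOn_weight {y : ℂ} (hy : ‖y‖ < M.r2) :
    ContinuousOn (M.weight y) (sphere 0 M.r2) := by
  unfold weight
  refine ContinuousOn.div (by fun_prop) (by fun_prop) fun z hz => ?_
  have hz' : ‖z‖ = M.r2 := by simpa using hz
  exact mul_ne_zero (mul_ne_zero (norm_pos_iff.1 (hz' ▸ r2_pos)) (sub_ne_zero_of_norm hy hz'))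
    (lam2_sub_mul_ne_zero hy hz')

/-- The sum of the contributions of two conjugate points `z`, `w` of the circle. -/
theorem add_conj_eq {x z w y Q : ℂ} (hzw : M.mu2 * M.c2 * (z * w) = (M.lam2 : ℂ))
    (hsum : M.mu2 * M.c2 * x * (z + w) = M.s * x - M.mu1 * M.c1 * x ^ 2 - M.lam1)
    (hz0 : z ≠ 0) (hw0 : w ≠ 0) (hx : x ≠ 0) (hzx : z - x ≠ 0) (hwx : w - x ≠ 0)
    (hzy : z - y ≠ 0) (hwy : w - y ≠ 0) (hx1 : 1 - x ≠ 0) :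
    z * ((z - 1) * x / (z - x) * (Q * M.weight y z))
      + w * ((w - 1) * x / (w - x) * (Q * M.weight y w)) =
    Q * -((M.mu1 * M.c1 * x ^ 2 - M.s * x + M.lam1) ^ 2 - 4 * (M.mu2 * M.c2) * M.lam2 * x ^ 2) /
      (M.K x y * (M.lam1 + M.lam2 - (M.mu1 * M.c1 + M.mu2 * M.c2) * x)) := by
  have hb : (M.mu2 * M.c2 : ℂ) ≠ 0 := by exact_mod_cast mul_mu2_c2_pos.ne'
  have e1 : M.weight y z = (w - z) / (z * (z - y) * (w - y)) := by
    rw [weight, show (M.lam2 - M.mu2 * M.c2 * z ^ 2 : ℂ) = M.mu2 * M.c2 * z * (w - z) by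
      linear_combination -hzw, show (M.lam2 - M.mu2 * M.c2 * y * z : ℂ) =
      M.mu2 * M.c2 * z * (w - y) by linear_combination -hzw]
    have := mul_ne_zero hb hz0
    rw [div_eq_div_iff (by simp_all) (by simp_all)]
    ring
  have e2 : M.weight y w = (z - w) / (w * (w - y) * (z - y)) := by
    rw [weight, show (M.lam2 - M.mu2 * M.c2 * w ^ 2 : ℂ) = M.mu2 * M.c2 * w * (z - w) by
      linear_combination -hzw, show (M.lam2 - M.mu2 * M.c2 * y * w : ℂ) =
      M.mu2 * M.c2 * w * (z - y) by linear_combination -hzw]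
    have := mul_ne_zero hb hw0
    rw [div_eq_div_iff (by simp_all) (by simp_all)]
    ring
  -- By `hsum` and `hzw`, z and w are the roots of K(x, ·). The identity `e4` is the case y = x with
  -- a factor x removed, and `e5` is the discriminant.
  have e3 : M.K x y = M.mu2 * M.c2 * x * ((z - y) * (w - y)) := by
    rw [Model.K]
    linear_combination y * hsum - x * hzw
  have e4 : (1 - x) * (M.lam1 + M.lam2 - (M.mu1 * M.c1 + M.mu2 * M.c2) * x : ℂ) =
      M.mu2 * M.c2 * ((z - x) * (w - x)) := by
    have hs : (M.s : ℂ) = M.lam1 + M.lam2 + M.mu1 * M.c1 + M.mu2 * M.c2 := by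
      simp [s]
    rw [hs] at hsum
    linear_combination -hzw + hsum
  have e5 : ((M.mu1 * M.c1 * x ^ 2 - M.s * x + M.lam1) ^ 2
      - 4 * (M.mu2 * M.c2) * M.lam2 * x ^ 2 : ℂ) = (M.mu2 * M.c2 * x * (z - w)) ^ 2 := by
    linear_combination (-(M.mu1 * M.c1 * x ^ 2 - M.s * x + M.lam1) + M.mu2 * M.c2 * x * (z + w))
      * (-hsum) + 4 * M.mu2 * M.c2 * x ^ 2 * hzw
  have e6 : (M.lam1 + M.lam2 - (M.mu1 * M.c1 + M.mu2 * M.c2) * x : ℂ) =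
      M.mu2 * M.c2 * ((z - x) * (w - x)) / (1 - x) := by
    rw [eq_div_iff hx1, ← e4]; ring
  rw [e1, e2, e3, e5, e6]
  have h1 := left_ne_zero_of_mul hb
  have h2 := right_ne_zero_of_mul hb
  field_simp
  ring

/-- The angle is chosen so that K(x, z) = 0 with |z| = r₂. As x < 1 and μ₁c₁ < λ₁, x is the smaller
root of K(·, z), so X₀(z) = x at z and at its conjugate. -/
theorem Stable.contour_eq (hM : M.Stable) {x : ℝ} (hx : x ∈ Set.Ioo M.x1 M.x2) {y : ℂ}
    (hy : ‖y‖ < M.r2) {F : ℂ → ℂ}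
    (hF : ∀ z, F z = M.ratio z * (P1 p (M.X0 z) * M.weight y z)) {z : ℂ}
    (hz : z = circleMap 0 M.r2 (Real.arccos (M.cosArg x))) :
    z * F z + starRingEnd ℂ z * F (starRingEnd ℂ z) =
      P1 p x * (√(-M.Delta2 x) : ℝ) ^ 2 /
        (M.K x y * (M.lam1 + M.lam2 - (M.mu1 * M.c1 + M.mu2 * M.c2) * x)) := by
  have ha := mul_mu1_c1_pos (M := M)
  have hx0 : 0 < x := x1_pos.trans hx.1
  have hx1 : x < 1 := hx.2.trans_le x2_le_one
  have hc := cosArg_mem_Ioo hx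
  have hn : ‖z‖ = M.r2 := by rw [hz, norm_circleMap_zero, abs_of_pos r2_pos]
  have hn' : ‖starRingEnd ℂ z‖ = M.r2 := by simpa using hn
  have hz0 : z ≠ 0 := norm_pos_iff.1 (hn ▸ r2_pos)
  have hw0 : starRingEnd ℂ z ≠ 0 := norm_pos_iff.1 (hn' ▸ r2_pos)
  have hzw : M.mu2 * M.c2 * (z * starRingEnd ℂ z) = (M.lam2 : ℂ) := by
    rw [Complex.mul_conj', hn, ← r2_sq]; push_cast; ring
  have hre : z.re = M.r2 * M.cosArg x := by
    rw [hz, circleMap_zero, Complex.re_ofReal_mul, Complex.exp_ofReal_mul_I_re,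
      Real.cos_arccos hc.1.le hc.2.le]
  have hsum : M.mu2 * M.c2 * x * (z + starRingEnd ℂ z) =
      (M.s * x - M.mu1 * M.c1 * x ^ 2 - M.lam1 : ℂ) := by
    have h : M.mu2 * M.c2 * x * (2 * (M.r2 * M.cosArg x)) =
        M.s * x - M.mu1 * M.c1 * x ^ 2 - M.lam1 := by
      have := M.mu2_pos.ne'
      have := M.c2_pos.ne'
      have := (r2_pos (M := M)).ne'
      rw [cosArg]
      field_simp
    rw [Complex.add_conj, hre]
    exact_mod_cast h
  have hK : M.K x z = 0 := by
    rw [Model.K]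
    linear_combination z * hsum - x * hzw
  have hX : M.X0 z = x := by
    refine hM.eq_X0 (hM.mem_annulus_of_norm_eq_r2 hn) hK ?_
    rw [Complex.norm_real, Real.norm_of_nonneg hx0.le]
    nlinarith [hM.1, mul_lt_mul_of_pos_left (by nlinarith : x ^ 2 < 1) ha]
  have hX' : M.X0 (starRingEnd ℂ z) = x := by rw [hM.X0_conj hn, hX]
  have hone : (1 - x : ℂ) ≠ 0 := by exact_mod_cast (sub_pos.2 hx1).ne'
  have hzx : ∀ w : ℂ, ‖w‖ = M.r2 → M.X0 w = x → w - x ≠ 0 := by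
    intro w hw hXw h
    have h1 := hM.eq_one_of_X0_eq (Or.inl hw) (hXw.trans (sub_eq_zero.1 h).symm)
    rw [h1] at h
    exact hone h
  have hD : ((√(-M.Delta2 x) : ℝ) : ℂ) ^ 2 = -((M.mu1 * M.c1 * x ^ 2 - M.s * x + M.lam1) ^ 2
      - 4 * (M.mu2 * M.c2) * M.lam2 * x ^ 2) := by
    rw [← Complex.ofReal_pow, Real.sq_sqrt (Delta2_neg hx).le, Delta2]
    push_cast; ring
  rw [hF, hF, ratio, ratio, hX, hX', hD]
  exact add_conj_eq hzw hsum hz0 hw0 (by exact_mod_cast hx0.ne') (hzx z hn hX) (hzx _ hn' hX')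
    (sub_ne_zero_of_norm hy hn) (sub_ne_zero_of_norm hy hn') hone

theorem Stable.intervalIntegrable_and_circleIntegral_eq (hM : M.Stable) (hp : M.IsStationary p)
    {y : ℂ} (hy : ‖y‖ < M.r2) :
    IntervalIntegrable (M.integrand1 p y) volume M.x1 M.x2 ∧
    (∮ z in C(0, M.r2), M.ratio z * (P1 p (M.X0 z) * M.weight y z)) =
      Complex.I * ∫ x in M.x1..M.x2, M.integrand1 p y x := by
  set F : ℂ → ℂ := fun z => M.ratio z * (P1 p (M.X0 z) * M.weight y z) with hF
  have ha := mul_mu1_c1_pos (M := M)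
  have hFi : CircleIntegrable F 0 M.r2 := by
    refine hM.circleIntegrable_ratio.mul_continuousOn
      (g := fun z => P1 p (M.X0 z) * M.weight y z) ?_
    rw [abs_of_pos r2_pos]
    exact (hM.continuousOn_P1_X0 hp).mul (continuousOn_weight hy)
  set h : ℝ → ℂ := fun θ => Complex.I * (circleMap 0 M.r2 θ * F (circleMap 0 M.r2 θ)
      + starRingEnd ℂ (circleMap 0 M.r2 θ) * F (starRingEnd ℂ (circleMap 0 M.r2 θ))) with hh
  obtain ⟨hhi, e1⟩ := circleIntegral_eq_integral_zero_pi hFi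
  set φ : ℝ → ℝ := fun x => Real.arccos (M.cosArg x) with hφ
  set φ' : ℝ → ℝ := fun x => -((M.lam1 - M.mu1 * M.c1 * x ^ 2) / (x * √(-M.Delta2 x))) with hφ'
  have hlt := x1_lt_x2 (M := M)
  have hc : ContinuousOn φ (Set.uIcc M.x1 M.x2) := by
    rw [Set.uIcc_of_le hlt.le]; exact continuousOn_arccos_cosArg
  have hd : ∀ x ∈ Set.Ioo (min M.x1 M.x2) (max M.x1 M.x2), HasDerivAt φ (φ' x) x := by
    rw [min_eq_left hlt.le, max_eq_right hlt.le]
    exact fun x hx => hasDerivAt_arccos_cosArg hx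
  have hn : ∀ x ∈ Set.Ioo (min M.x1 M.x2) (max M.x1 M.x2), φ' x ≤ 0 := by
    rw [min_eq_left hlt.le, max_eq_right hlt.le]
    intro x hx
    have hx0 : 0 < x := x1_pos.trans hx.1
    have hx1 : x < 1 := hx.2.trans_le x2_le_one
    refine neg_nonpos.2 (div_nonneg ?_ (by positivity))
    nlinarith [hM.1, mul_lt_mul_of_pos_left (by nlinarith : x ^ 2 < 1) ha]
  have heq : ∀ x ∈ Set.Ioo M.x1 M.x2, φ' x • (h ∘ φ) x = -Complex.I * M.integrand1 p y x := by
    intro x hx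
    have hx0 : (x : ℂ) ≠ 0 := by exact_mod_cast (x1_pos.trans hx.1).ne'
    have hs : ((√(-M.Delta2 x) : ℝ) : ℂ) ≠ 0 := by
      exact_mod_cast (Real.sqrt_pos.2 (Delta2_neg hx)).ne'
    simp only [Function.comp_apply, hh]
    rw [hM.contour_eq hx hy (fun z => rfl) rfl, Complex.real_smul, integrand1]
    simp only [hφ']
    push_cast
    field_simp
  -- The monotone change of variables needs no continuity of `h` and no derivative at the endpoints,
  -- where the derivative formula has √(-Δ₂) = 0 in its denominator. It also transfers integrability
  -- from [0, π] to [x₁, x₂].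
  have i1 := (intervalIntegral.integrable_deriv_smul_comp_iff_of_deriv_nonpos (g := h) hc hd hn)
  have i2 := intervalIntegral.integral_deriv_smul_comp_of_deriv_nonpos (g := h) hc hd hn
  have hφ1 : φ M.x1 = π := by simp [hφ, cosArg_x1]
  have hφ2 : φ M.x2 = 0 := by simp [hφ, cosArg_x2]
  rw [hφ1, hφ2] at i1 i2
  have i3 : IntervalIntegrable (fun x => -Complex.I * M.integrand1 p y x) volume M.x1 M.x2 :=
    (i1.2 hhi.symm).congr_uIoo (by rwa [Set.uIoo_of_le hlt.le])
  have i4 : ∫ x in M.x1..M.x2, φ' x • (h ∘ φ) x =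
      ∫ x in M.x1..M.x2, -Complex.I * M.integrand1 p y x :=
    intervalIntegral.integral_congr_Ioo_of_le hlt.le heq
  constructor
  · have := i3.const_mul Complex.I
    simpa [← mul_assoc] using this
  · rw [e1, ← neg_neg (∫ θ in (0)..π, _), ← intervalIntegral.integral_symm]
    rw [i4, intervalIntegral.integral_const_mul] at i2
    rw [← i2]
    ring

/-! ### The P₂⁻ term and the assembly of the formula. -/

theorem integrand2_eq {y z : ℂ} (hy : ‖y‖ < M.r2) (hz : ‖z‖ = M.r2) :
    M.integrand2 p y z = M.ratio z * (M.P2minus p z * M.weight y z) := by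
  have hz0 : z ≠ 0 := norm_pos_iff.1 (hz ▸ r2_pos)
  have hX := X0_ne_zero (M := M) hz0
  have h1 := lam2_sub_mul_ne_zero hy hz
  have h2 := sub_ne_zero_of_norm hy hz
  have hK : M.K (M.X0 z) y = M.X0 z * (z - y) * (M.lam2 - M.mu2 * M.c2 * y * z) / z := by
    rw [eq_div_iff hz0]
    linear_combination K_X0_eq (M := M) hz0 y
  rw [integrand2, ratio, weight, hK]
  -- At the singular point both sides are 0 by the division convention.
  by_cases h : z - M.X0 z = 0
  · simp [h]
  field_simp

theorem Stable.circleIntegrable_integrand2 (hM : M.Stable) {y : ℂ} (hy : ‖y‖ < M.r2) :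
    CircleIntegrable (M.integrand2 p y) 0 M.r2 := by
  have h : CircleIntegrable (fun z => M.ratio z * (M.P2minus p z * M.weight y z)) 0 M.r2 := by
    refine hM.circleIntegrable_ratio.mul_continuousOn
      (g := fun z => M.P2minus p z * M.weight y z) ?_
    rw [abs_of_pos r2_pos]
    exact differentiable_P2minus.continuous.continuousOn.mul (continuousOn_weight hy)
  refine (circleIntegrable_congr fun z hz => ?_).1 h
  rw [abs_of_pos r2_pos] at hz
  exact (integrand2_eq hy (by simpa using hz)).symm

/-- The three kernels are the partial fractions of y · `weight y z`: they give P₂(y), P₂(0) and the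
vanishing integral. -/
theorem continuation_mul_eq {y z : ℂ} (hy : ‖y‖ < M.r2) (hz : ‖z‖ = M.r2) :
    M.continuation p z * (z - y)⁻¹ - M.continuation p z * (z - 0)⁻¹
      - y * (M.mu2 * M.c2) * (M.continuation p z * (M.lam2 - M.mu2 * M.c2 * y * z)⁻¹) =
    y * (M.lam2 / M.lam1) * (M.ratio z * (P1 p (M.X0 z) * M.weight y z))
      + y * M.integrand2 p y z := by
  have hz0 : z ≠ 0 := norm_pos_iff.1 (hz ▸ r2_pos)
  have h1 := lam2_sub_mul_ne_zero hy hz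
  have h2 := sub_ne_zero_of_norm hy hz
  have h3 : (z - y)⁻¹ - z⁻¹ - y * (M.mu2 * M.c2) * (M.lam2 - M.mu2 * M.c2 * y * z)⁻¹ =
      y * M.weight y z := by
    rw [weight]
    obtain ⟨D, hD⟩ : ∃ D, D = (M.lam2 - M.mu2 * M.c2 * y * z : ℂ) := ⟨_, rfl⟩
    rw [← hD] at h1 ⊢
    field_simp
    rw [hD]
    ring
  rw [integrand2_eq hy hz, continuation, sub_zero]
  linear_combination M.ratio z * (M.lam2 / M.lam1 * P1 p (M.X0 z) + M.P2minus p z) * h3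

theorem Stable.circleIntegral_eq (hM : M.Stable) (hp : M.IsStationary p) {y : ℂ}
    (hy : ‖y‖ < M.r2) :
    (∮ z in C(0, M.r2), M.continuation p z * (z - y)⁻¹)
      - (∮ z in C(0, M.r2), M.continuation p z * (z - 0)⁻¹) =
    y * (M.lam2 / M.lam1) * (Complex.I * ∫ x in M.x1..M.x2, M.integrand1 p y x)
      + y * ∮ z in C(0, M.r2), M.integrand2 p y z := by
  have hC := hM.circleIntegrable_continuation hp
  have hmul : ∀ g : ℂ → ℂ, (∀ z, ‖z‖ = M.r2 → g z ≠ 0) → Continuous g →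
      CircleIntegrable (fun z => M.continuation p z * (g z)⁻¹) 0 M.r2 := fun g h0 hg => by
    refine hC.mul_continuousOn (g := fun z => (g z)⁻¹) ?_
    rw [abs_of_pos r2_pos]
    exact hg.continuousOn.inv₀ fun z hz => h0 z (by simpa using hz)
  have c1 := hmul (fun z => z - y) (fun z hz => sub_ne_zero_of_norm hy hz) (by fun_prop)
  have c2 := hmul (fun z => z - 0) (fun z hz => sub_ne_zero_of_norm (by simpa using r2_pos) hz)
    (by fun_prop)
  have c3 := hmul (fun z => M.lam2 - M.mu2 * M.c2 * y * z) (fun z hz => lam2_sub_mul_ne_zero hy hz)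
    (by fun_prop)
  have c4 : CircleIntegrable (fun z => M.ratio z * (P1 p (M.X0 z) * M.weight y z)) 0 M.r2 := by
    refine hM.circleIntegrable_ratio.mul_continuousOn
      (g := fun z => P1 p (M.X0 z) * M.weight y z) ?_
    rw [abs_of_pos r2_pos]
    exact (hM.continuousOn_P1_X0 hp).mul (continuousOn_weight hy)
  have c5 := hM.circleIntegrable_integrand2 (p := p) hy
  have h := circleIntegral.integral_congr (c := 0) r2_pos.le fun z (hz : z ∈ sphere 0 M.r2) =>
    continuation_mul_eq (p := p) hy (mem_sphere_zero_iff_norm.1 hz)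
  have c12 : CircleIntegrable (fun z => M.continuation p z * (z - y)⁻¹
      - M.continuation p z * (z - 0)⁻¹) 0 M.r2 := c1.sub c2
  have hsmul : ∀ (a : ℂ) {g : ℂ → ℂ}, CircleIntegrable g 0 M.r2 →
      CircleIntegrable (fun z => a * g z) 0 M.r2 := fun a g hg => hg.const_smul
  rw [circleIntegral.integral_sub c12 (hsmul (y * (M.mu2 * M.c2)) c3),
    circleIntegral.integral_sub c1 c2, circleIntegral.integral_const_mul,
    hM.circleIntegral_continuation_mul_inv hp hy, mul_zero, sub_zero,
    circleIntegral.integral_add (hsmul (y * (M.lam2 / M.lam1)) c4) (hsmul y c5),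
    circleIntegral.integral_const_mul,
    circleIntegral.integral_const_mul,
    (hM.intervalIntegrable_and_circleIntegral_eq hp hy).2] at h
  exact h

end Model
end TrunkReservation

end

theorem mainTheorem3 (M : TrunkReservation.Model) (hM : M.Stable)
    (p : ℕ × ℕ → ℝ) (hp : M.IsStationary p) (y : ℂ) (hy : ‖y‖ < M.r2) :
    Summable (fun n : ℕ => (p (0, n) : ℂ) * y ^ n) ∧
    IntervalIntegrable (M.integrand1 p y) MeasureTheory.volume M.x1 M.x2 ∧
    CircleIntegrable (M.integrand2 p y) 0 M.r2 ∧
    TrunkReservation.P2 p y =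
      y * M.lam2 / (2 * Real.pi * M.lam1) * (∫ x in M.x1..M.x2, M.integrand1 p y x)
        + y / (2 * Real.pi * Complex.I) * (∮ z in C(0, M.r2), M.integrand2 p y z)
        + TrunkReservation.P p 0 0 := by
  have h := hM.hasSum_P2 hp hy
  -- At y = 0 Cauchy's formula identifies the 1/z integral with p(0, 0) = P(0, 0), the constant term
  -- of the formula.
  have h0 := hM.hasSum_P2 hp (y := 0) (by simpa using TrunkReservation.Model.r2_pos)
  have e0 : (p (0, 0) : ℂ) = _ :=
    HasSum.unique (by
      simpa using hasSum_single (f := fun n : ℕ => (p (0, n) : ℂ) * 0 ^ n) 0 (by simp +contextual))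
      h0
  have eP : TrunkReservation.P p 0 0 = p (0, 0) := by
    rw [TrunkReservation.P, tsum_eq_single (0, 0)]
    · simp
    · rintro ⟨i, j⟩ hij
      rcases Nat.eq_zero_or_pos i with rfl | hi
      · rcases Nat.eq_zero_or_pos j with rfl | hj
        · exact absurd rfl hij
        · simp [hj.ne']
      · simp [hi.ne']
  refine ⟨h.summable, (hM.intervalIntegrable_and_circleIntegral_eq hp hy).1,
    hM.circleIntegrable_integrand2 hy, ?_⟩
  rw [TrunkReservation.P2, h.tsum_eq, eP, e0]
  have key := hM.circleIntegral_eq hp hy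
  have h1 : (M.lam1 : ℂ) ≠ 0 := by exact_mod_cast M.lam1_pos.ne'
  have hpi : (Real.pi : ℂ) ≠ 0 := by exact_mod_cast Real.pi_ne_zero
  rw [sub_eq_iff_eq_add.1 key]
  field_simp [Complex.I_ne_zero]
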